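/- **The simplicial set of relations.** Let $\mathcal V$ be a family of sets. Define sets $\mathcal S_n$ ($n\ge 0$) recursively. A $0$-simplex is a set $v$ together with a specified $V\in\mathcal V$ such that $v\subseteq V$. For $n\ge 1$, an $n$-simplex $y$ consists of $(n-1)$-simplices $d_0y,\dots,d_ny$ with $d_pd_qy=d_{q-1}d_py$ for all $p<q$ (no condition if $n=1$), together with a subset, again denoted $y$, of $d_0y\times\cdots\times d_ny$. For $n\ge1$ and $a=(a_0,\dots,a_n)$ in such a product put $e_ja=a_j$. The degeneracy $s_jy$ ($0\le j\le n$) of $y\in\mathcal S_n$ is the $(n+1)$-simplex with faces $d_js_jy=d_{j+1}s_jy=y$, $d_ks_jy=s_{j-1}d_ky$ for $k<j$ and $d_ks_jy=s_jd_{k-1}y$ for $k>j+1$, whose elements are the $c_ja$ with $a\in y$, where $c_ja$ is given by $e_jc_ja=e_{j+1}c_ja=a$, $e_kc_ja=c_{j-1}e_ka$ for $k<j$ and $e_kc_ja=c_je_{k-1}a$ for $k>j+1$. With these faces and degeneracies $\mathcal S=\mathcal S(\mathcal V)$ is a simplicial set. **Properties of simplices.** A family $(b_j)_{j\in A}$ with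 $b_j\in d_jy$, $A\subseteq\{0,\dots,n\}$, is a *partial element* of $y\in\mathcal S_n$ ($n\ge2$) if $e_pb_q=e_{q-1}b_p$ for all $p<q$ in $A$. The simplex $y\in\mathcal S_n$ is * *e-simplicial* if $n\le1$, or if $n\ge 2$ and $e_pe_qa=e_{q-1}e_pa$ for all $a\in y$ and all $p<q$; * *subface-simplicial* if $y$ and all its iterated faces are e-simplicial; * *$k$-surjective* ($n\ge 1$, $0\le k\le n$) if $e_k:y\to d_ky$ is surjective; * *$A$-determinate* ($n\ge2$) if for every partial element $(b_j)_{j\in A}$ of $y$ there is $a\in y$ with $e_ja=b_j$ for all $j\in A$. For $n\ge1$ and $0\le i\le n+1$, a simplex $w\in\mathcal S_{n+1}$ is an *$(n,i)$-composition* if it is e-simplicial; if for every partial element $(b_j)_{j\ne i}$ of $w$ the list $b_i=(e_{i-1}b_0,\dots,e_{i-1}b_{i-1},e_ib_{i+1},\dots,e_ib_{n+1})$ belongs to $d_iw$ and $(b_0,\dots,b_{n+1})\in w$; and if $d_iw=\{e_ib: b\in w\}$. **Composers.** For a simplicial set $C$ and $m\ge1$ let $\Lambda^i(m)(C)$ be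 the set of families $(x_j)_{0\le j\le m,\,j\ne i}$ of $(m-1)$-simplices of $C$ with $d_px_q=d_{q-1}x_p$ for all $p<q$ different from $i$ (no condition if $m=1$). For $n\geq 1$ and $0\le i\le n+1$, $C$ is an *$(n,i)$-composer* if for every $m>n$ the map $C_m\to\Lambda^i(m)(C)$, $x\mapsto(d_jx)_{j\ne i}$, is a bijection. A *subcomplex* is a family of subsets $\mathcal S'_m\subseteq\mathcal S_m$ ($m\ge 0$) closed under faces and degeneracies; an *$n$-truncated subcomplex* is such a family for $m\le n$ only, closed under the faces and degeneracies between these dimensions; $\mathrm{Tr}^n(\mathcal S')$ is the $n$-truncated subcomplex $(\mathcal S'_m)_{m\le n}$. **Theorem.** Let $1<i<n$ and let $\mathcal S'_{\le n}$ be an $n$-truncated subcomplex of $\mathcal S$ such that 1. every $y\in\mathcal S'_n$ is subface-simplicial, $i$-surjective, $(i-1)$-surjective and $\{i-2,i+1\}$-determinate; and 2. whenever $w\in\mathcal S_{n+1}$ is an $(n,i)$-composition with $d_jw\in\mathcal S'_n$ for all $j\ne i$, and $d_iw$ has the four properties in (1), then $d_iw\in\mathcal S'_n$. Then there is a subcomplex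 $\mathcal S'\subseteq\mathcal S$ such that $\mathrm{Tr}^n(\mathcal S')$ is the given $\mathcal S'_{\le n}$, such that $\mathcal S'$ is an $(n,i)$-composer, and such that for every $m\ge n+1$ the set $\mathcal S'_m$ consists exactly of the $(m-1,i)$-compositions $w\in\mathcal S_m$ with $d_jw\in\mathcal S'_{m-1}$ for all $j\ne i$. -/

import Mathlib

universe u

/-! ### Simplicial sets by faces and degeneracies, subcomplexes, horns, composers -/

/-- A simplicial set, presented by its sets of simplices, its face maps and degeneracy maps,
subject to the five simplicial identities (indexed as for `SSet.δ`, `SSet.σ` in Mathlib). -/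
structure SimplicialSystem where
  /-- the set of `n`-simplices -/
  obj : ℕ → Type u
  /-- the face map `d_j` -/
  d : ∀ {n : ℕ}, Fin (n + 2) → obj (n + 1) → obj n
  /-- the degeneracy map `s_j` -/
  s : ∀ {n : ℕ}, Fin (n + 1) → obj n → obj (n + 1)
  d_d : ∀ {n : ℕ} (x : obj (n + 2)) (i j : Fin (n + 2)), i ≤ j →
    d i (d j.succ x) = d j (d i.castSucc x)
  d_s_of_le : ∀ {n : ℕ} (x : obj (n + 1)) (i : Fin (n + 2)) (j : Fin (n + 1)), i ≤ j.castSucc →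
    d i.castSucc (s j.succ x) = s j (d i x)
  d_s_castSucc : ∀ {n : ℕ} (x : obj n) (j : Fin (n + 1)), d j.castSucc (s j x) = x
  d_s_succ : ∀ {n : ℕ} (x : obj n) (j : Fin (n + 1)), d j.succ (s j x) = x
  d_s_of_gt : ∀ {n : ℕ} (x : obj (n + 1)) (i : Fin (n + 2)) (j : Fin (n + 1)), j.castSucc < i →
    d i.succ (s j.castSucc x) = s j (d i x)
  s_s : ∀ {n : ℕ} (x : obj n) (i j : Fin (n + 1)), i ≤ j →
    s j.succ (s i x) = s i.castSucc (s j x)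

namespace SimplicialSystem

/-- A subcomplex: a set of simplices in each dimension, closed under faces and degeneracies. -/
@[ext]
structure Subcomplex (X : SimplicialSystem.{u}) where
  /-- the `m`-simplices of the subcomplex -/
  carrier : ∀ m : ℕ, Set (X.obj m)
  d_mem : ∀ {m : ℕ} (j : Fin (m + 2)) (x : X.obj (m + 1)), x ∈ carrier (m + 1) → X.d j x ∈ carrier m
  s_mem : ∀ {m : ℕ} (j : Fin (m + 1)) (x : X.obj m), x ∈ carrier m → X.s j x ∈ carrier (m + 1)

/-- An `n`-truncated subcomplex: a set of `m`-simplices for each `m ≤ n`, closed under those faces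
and degeneracies which do not leave the dimensions `≤ n`. -/
@[ext]
structure TruncSubcomplex (X : SimplicialSystem.{u}) (n : ℕ) where
  /-- the `m`-simplices of the truncated subcomplex, `m ≤ n` -/
  carrier : ∀ m : ℕ, m ≤ n → Set (X.obj m)
  d_mem : ∀ {m : ℕ} (h : m + 1 ≤ n) (j : Fin (m + 2)) (x : X.obj (m + 1)),
    x ∈ carrier (m + 1) h → X.d j x ∈ carrier m (Nat.le_of_succ_le h)
  s_mem : ∀ {m : ℕ} (h : m + 1 ≤ n) (j : Fin (m + 1)) (x : X.obj m),
    x ∈ carrier m (Nat.le_of_succ_le h) → X.s j x ∈ carrier (m + 1) h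

/-- The `n`-truncation of a subcomplex. -/
def Subcomplex.trunc {X : SimplicialSystem.{u}} (Y : X.Subcomplex) (n : ℕ) :
    X.TruncSubcomplex n where
  carrier m _ := Y.carrier m
  d_mem _ j x hx := Y.d_mem j x hx
  s_mem _ j x hx := Y.s_mem j x hx

/-- A subcomplex is itself a simplicial set. -/
def Subcomplex.toSystem {X : SimplicialSystem.{u}} (Y : X.Subcomplex) : SimplicialSystem.{u} where
  obj m := {x : X.obj m // x ∈ Y.carrier m}
  d j x := ⟨X.d j x.1, Y.d_mem j x.1 x.2⟩
  s j x := ⟨X.s j x.1, Y.s_mem j x.1 x.2⟩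
  d_d x i j h := Subtype.ext (X.d_d x.1 i j h)
  d_s_of_le x i j h := Subtype.ext (X.d_s_of_le x.1 i j h)
  d_s_castSucc x j := Subtype.ext (X.d_s_castSucc x.1 j)
  d_s_succ x j := Subtype.ext (X.d_s_succ x.1 j)
  d_s_of_gt x i j h := Subtype.ext (X.d_s_of_gt x.1 i j h)
  s_s x i j h := Subtype.ext (X.s_s x.1 i j h)

/-- The matching condition on a family of `m`-simplices indexed by the positions `j ≠ i` in
`{0, …, m+1}`: `d_p x_q = d_{q-1} x_p` for all positions `p < q`. (A pair of positions `p < q` is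
written as `p.castSucc`, `q.succ` with `p ≤ q`; for `m = 0` there is no condition.) -/
def HornCompatible (X : SimplicialSystem.{u}) (i : ℕ) :
    ∀ {m : ℕ}, ({j : Fin (m + 2) // j.val ≠ i} → X.obj m) → Prop
  | 0, _ => True
  | m + 1, x => ∀ (p q : Fin (m + 2)) (hp : p.castSucc.val ≠ i) (hq : q.succ.val ≠ i), p ≤ q →
      X.d p (x ⟨q.succ, hq⟩) = X.d q (x ⟨p.castSucc, hp⟩)

/-- The set `Λ^i(m+1)(X)` of open `i`-horns of dimension `m + 1`. -/
def Horn (X : SimplicialSystem.{u}) (i m : ℕ) : Type u :=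
  {x : {j : Fin (m + 2) // j.val ≠ i} → X.obj m // X.HornCompatible i x}

/-- The map `φ_{m+1,i} : X_{m+1} → Λ^i(m+1)(X)`, `x ↦ (d_j x)_{j ≠ i}`. -/
def hornMap (X : SimplicialSystem.{u}) (i m : ℕ) (x : X.obj (m + 1)) : X.Horn i m :=
  ⟨fun j => X.d j.1 x, by
    cases m with
    | zero => trivial
    | succ m => exact fun p q _ _ h => X.d_d x p q h⟩

/-- `X` is an `(n,i)`-composer (`n ≥ 1`, `0 ≤ i ≤ n + 1`): in each dimension greater than `n`,
every open `i`-horn of `X` has exactly one filler. -/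
def IsComposer (X : SimplicialSystem.{u}) (n i : ℕ) : Prop :=
  ∀ m : ℕ, n ≤ m → Function.Bijective (X.hornMap i m)

end SimplicialSystem

/-! ### The simplicial set of relations -/

namespace SetRelations

/-- Arrays: the possible elements of `n`-dimensional relations. An array of dimension `n + 1` is
a list `(a_0, …, a_{n+1})` of arrays of dimension `n`; an array of dimension `0` is a point. -/
def Arr (U : Type u) : ℕ → Type u
  | 0 => U
  | n + 1 => Fin (n + 2) → Arr U n

/-- Raw data of an `n`-simplex: in dimension `0` a pair `(V, v)` of sets (meant: `v ⊆ V`); in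
dimension `n + 1` a list of `n + 2` faces together with the set of elements of the relation. -/
def PreSimplex (U : Type u) : ℕ → Type u
  | 0 => Set U × Set U
  | n + 1 => (Fin (n + 2) → PreSimplex U n) × Set (Arr U (n + 1))

variable {U : Type u}

/-- The set of elements (the domain) of the relation. -/
def PreSimplex.elem : ∀ {n : ℕ}, PreSimplex U n → Set (Arr U n)
  | 0, y => y.2
  | _ + 1, y => y.2

/-- The `j`-th face. -/
def PreSimplex.face {n : ℕ} (j : Fin (n + 2)) (y : PreSimplex U (n + 1)) : PreSimplex U n :=
  y.1 j

/-- `d_p y_q = d_{q-1} y_p` for all `p < q`, for a list `y_0, …, y_{n+1}` of `n`-dimensional data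
(no condition if `n = 0`). -/
def FacesCompatible : ∀ {n : ℕ}, (Fin (n + 2) → PreSimplex U n) → Prop
  | 0, _ => True
  | n + 1, y => ∀ p q : Fin (n + 2), p ≤ q → (y q.succ).face p = (y p.castSucc).face q

/-- The `n`-simplices of the simplicial set of relations on the family `𝒱` of sets: in dimension
`0`, a subset `v` of a member `V` of `𝒱`; in dimension `n + 1`, a subset of the product of the
domains of `n + 2` matching `n`-simplices. -/
def IsSimplex (𝒱 : Set (Set U)) : ∀ {n : ℕ}, PreSimplex U n → Prop
  | 0, y => y.1 ∈ 𝒱 ∧ y.2 ⊆ y.1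
  | _ + 1, y => (∀ j, IsSimplex 𝒱 (y.1 j)) ∧ FacesCompatible y.1 ∧
      ∀ a ∈ y.2, ∀ j, a j ∈ (y.1 j).elem

/-- Given maps `c_0, …, c_n` and a list `a_0, …, a_{n+1}`, the list
`(c_{j-1} a_0, …, c_{j-1} a_{j-1}, x, x, c_j a_{j+1}, …, c_j a_{n+1})`. -/
def degList {α β : Type u} {n : ℕ} (c : Fin (n + 1) → α → β) (j : Fin (n + 2))
    (a : Fin (n + 2) → α) (x : β) (k : Fin (n + 3)) : β :=
  if h : k.val < j.val then c ⟨j.val - 1, by omega⟩ (a ⟨k.val, by omega⟩)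
  else if h' : k.val ≤ j.val + 1 then x
  else c ⟨j.val, by omega⟩ (a ⟨k.val - 1, by omega⟩)

/-- The maps `c_j` on arrays. -/
def arrDeg : ∀ {n : ℕ}, Fin (n + 1) → Arr U n → Arr U (n + 1)
  | 0, _, t => fun _ => t
  | _ + 1, j, a => degList arrDeg j a a

/-- The degeneracies `s_j`: the elements of `s_j y` are the `c_j a` with `a` an element of `y`. -/
def PreSimplex.deg : ∀ {n : ℕ}, Fin (n + 1) → PreSimplex U n → PreSimplex U (n + 1)
  | 0, j, y => (fun _ => y, arrDeg j '' y.elem)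
  | _ + 1, j, y => (degList PreSimplex.deg j y.1 y, arrDeg j '' y.elem)

section degList

variable {α β : Type u} {n : ℕ} (c : Fin (n + 1) → α → β) (a : Fin (n + 2) → α) (x : β)

theorem degList_castSucc (j : Fin (n + 2)) : degList c j a x j.castSucc = x := by
  simp [degList]

theorem degList_succ (j : Fin (n + 2)) : degList c j a x j.succ = x := by
  simp [degList]

theorem degList_of_le (i : Fin (n + 2)) (j : Fin (n + 1)) (h : i ≤ j.castSucc) :
    degList c j.succ a x i.castSucc = c j (a i) := by
  have h' : i.val ≤ j.val := h
  have h1 : i.val < j.val + 1 := by omega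
  simp [degList, h1]

theorem degList_of_gt (i : Fin (n + 2)) (j : Fin (n + 1)) (h : j.castSucc < i) :
    degList c j.castSucc a x i.succ = c j (a i) := by
  have h' : j.val < i.val := h
  have h1 : ¬ i.val + 1 < j.val := by omega
  have h2 : ¬ i.val ≤ j.val := by omega
  simp [degList, h1, h2]

/-- Every position is one of those covered by the four rules above. -/
theorem degList_cases (j : Fin (n + 2)) (k : Fin (n + 3)) :
    k = j.castSucc ∨ k = j.succ ∨
    (∃ (i : Fin (n + 2)) (j' : Fin (n + 1)), i ≤ j'.castSucc ∧ j = j'.succ ∧ k = i.castSucc) ∨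
    (∃ (i : Fin (n + 2)) (j' : Fin (n + 1)), j'.castSucc < i ∧ j = j'.castSucc ∧ k = i.succ) := by
  rcases lt_trichotomy k.val j.val with h | h | h
  · refine Or.inr (Or.inr (Or.inl ⟨⟨k.val, by omega⟩, ⟨j.val - 1, by omega⟩, ?_, ?_, ?_⟩))
    · simp only [Fin.le_def, Fin.val_castSucc]; omega
    · ext; simp only [Fin.val_succ]; omega
    · ext; simp
  · exact Or.inl (Fin.ext h)
  · by_cases h' : k.val = j.val + 1
    · exact Or.inr (Or.inl (Fin.ext (by simpa using h')))
    · refine Or.inr (Or.inr (Or.inr ⟨⟨k.val - 1, by omega⟩, ⟨j.val, by omega⟩, ?_, ?_, ?_⟩))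
      · simp only [Fin.lt_def, Fin.val_castSucc]; omega
      · ext; simp
      · ext; simp only [Fin.val_succ]; omega

theorem degList_comm {γ : Type u} (c' : Fin (n + 2) → β → γ)
    (hc : ∀ (i j : Fin (n + 1)) (y : α), i ≤ j → c' j.succ (c i y) = c' i.castSucc (c j y))
    (i j : Fin (n + 2)) (h : i ≤ j) (k : Fin (n + 4)) :
    degList c' j.succ (degList c i a x) (c' i x) k =
      degList c' i.castSucc (degList c j a x) (c' j x) k := by
  have hc' : ∀ (i j k l : ℕ) (hi : i < n + 1) (hj : j < n + 1) (hk : k < n + 2) (hl : l < n + 2)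
      (y y' : α), y = y' → i ≤ j → k = j + 1 → l = i →
      c' ⟨k, hk⟩ (c ⟨i, hi⟩ y) = c' ⟨l, hl⟩ (c ⟨j, hj⟩ y') := by
    rintro i j k l hi hj hk hl y y' rfl hij rfl rfl
    exact hc ⟨_, hi⟩ ⟨_, hj⟩ y hij
  obtain ⟨i, hi⟩ := i
  obtain ⟨j, hj⟩ := j
  obtain ⟨k, hk⟩ := k
  have h' : i ≤ j := h
  simp only [degList, Fin.succ_mk, Fin.castSucc_mk]
  split_ifs <;> first
    | omega
    | rfl
    | (congr 2; omega)
    | (apply hc' <;> first | omega | rfl)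

end degList

theorem arrDeg_arrDeg : ∀ {n : ℕ} (a : Arr U n) (i j : Fin (n + 1)), i ≤ j →
    arrDeg j.succ (arrDeg i a) = arrDeg i.castSucc (arrDeg j a)
  | 0, t, i, j, _ => by
    funext k
    change degList arrDeg j.succ _ _ k = degList arrDeg i.castSucc _ _ k
    simp only [degList]
    split_ifs <;> rfl
  | n + 1, a, i, j, h => by
    funext k
    exact degList_comm arrDeg a a arrDeg (fun i j y h => arrDeg_arrDeg y i j h) i j h k

theorem arrDeg_castSucc : ∀ {n : ℕ} (a : Arr U n) (j : Fin (n + 1)), arrDeg j a j.castSucc = a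
  | 0, _, _ => rfl
  | _ + 1, a, j => degList_castSucc _ a a j

theorem arrDeg_succ : ∀ {n : ℕ} (a : Arr U n) (j : Fin (n + 1)), arrDeg j a j.succ = a
  | 0, _, _ => rfl
  | _ + 1, a, j => degList_succ _ a a j

theorem arrDeg_of_le {n : ℕ} (a : Arr U (n + 1)) (i : Fin (n + 2)) (j : Fin (n + 1))
    (h : i ≤ j.castSucc) : arrDeg j.succ a i.castSucc = arrDeg j (a i) :=
  degList_of_le _ a a i j h

theorem arrDeg_of_gt {n : ℕ} (a : Arr U (n + 1)) (i : Fin (n + 2)) (j : Fin (n + 1))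
    (h : j.castSucc < i) : arrDeg j.castSucc a i.succ = arrDeg j (a i) :=
  degList_of_gt _ a a i j h

theorem PreSimplex.elem_deg : ∀ {n : ℕ} (y : PreSimplex U n) (j : Fin (n + 1)),
    (y.deg j).elem = arrDeg j '' y.elem
  | 0, _, _ => rfl
  | _ + 1, _, _ => rfl

theorem PreSimplex.face_castSucc_deg : ∀ {n : ℕ} (y : PreSimplex U n) (j : Fin (n + 1)),
    (y.deg j).face j.castSucc = y
  | 0, _, _ => rfl
  | _ + 1, y, j => degList_castSucc _ y.1 y j

theorem PreSimplex.face_succ_deg : ∀ {n : ℕ} (y : PreSimplex U n) (j : Fin (n + 1)),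
    (y.deg j).face j.succ = y
  | 0, _, _ => rfl
  | _ + 1, y, j => degList_succ _ y.1 y j

theorem PreSimplex.face_deg_of_le {n : ℕ} (y : PreSimplex U (n + 1)) (i : Fin (n + 2))
    (j : Fin (n + 1)) (h : i ≤ j.castSucc) :
    (y.deg j.succ).face i.castSucc = (y.face i).deg j :=
  degList_of_le _ y.1 y i j h

theorem PreSimplex.face_deg_of_gt {n : ℕ} (y : PreSimplex U (n + 1)) (i : Fin (n + 2))
    (j : Fin (n + 1)) (h : j.castSucc < i) :
    (y.deg j.castSucc).face i.succ = (y.face i).deg j :=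
  degList_of_gt _ y.1 y i j h

theorem PreSimplex.deg_deg : ∀ {n : ℕ} (y : PreSimplex U n) (i j : Fin (n + 1)), i ≤ j →
    (y.deg i).deg j.succ = (y.deg j).deg i.castSucc := by
  have helem : ∀ {n : ℕ} (y : PreSimplex U n) (i j : Fin (n + 1)), i ≤ j →
      arrDeg j.succ '' (y.deg i).elem = arrDeg i.castSucc '' (y.deg j).elem := by
    intro n y i j h
    rw [elem_deg, elem_deg, Set.image_image, Set.image_image]
    exact Set.image_congr fun a _ => arrDeg_arrDeg a i j h
  intro n
  induction n with
  | zero =>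
    intro y i j h
    refine Prod.ext ?_ (helem y _ _ h)
    funext k
    change degList PreSimplex.deg j.succ (fun _ => y) (y.deg i) k =
      degList PreSimplex.deg i.castSucc (fun _ => y) (y.deg j) k
    simp only [degList]
    split_ifs <;> rfl
  | succ n ih =>
    intro y i j h
    refine Prod.ext ?_ (helem y _ _ h)
    funext k
    exact degList_comm PreSimplex.deg y.1 y PreSimplex.deg (fun i j y h => ih y i j h) i j h k

theorem PreSimplex.face_deg_self {n : ℕ} (y : PreSimplex U n) (k : Fin (n + 2)) (j : Fin (n + 1))
    (h : k.val = j.val ∨ k.val = j.val + 1) : (y.deg j).face k = y := by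
  rcases h with h | h
  · obtain rfl : k = j.castSucc := Fin.ext h
    exact y.face_castSucc_deg j
  · obtain rfl : k = j.succ := Fin.ext h
    exact y.face_succ_deg j

theorem PreSimplex.face_deg_left {n : ℕ} (y : PreSimplex U (n + 1)) {k : Fin (n + 3)}
    {j : Fin (n + 2)} (k' : Fin (n + 2)) (j' : Fin (n + 1)) (hk : k.val = k'.val)
    (hj : j.val = j'.val + 1) (h : k'.val ≤ j'.val) :
    (y.deg j).face k = (y.face k').deg j' := by
  obtain rfl : k = k'.castSucc := Fin.ext hk
  obtain rfl : j = j'.succ := Fin.ext hj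
  exact y.face_deg_of_le _ _ h

theorem PreSimplex.face_deg_right {n : ℕ} (y : PreSimplex U (n + 1)) {k : Fin (n + 3)}
    {j : Fin (n + 2)} (k' : Fin (n + 2)) (j' : Fin (n + 1)) (hk : k.val = k'.val + 1)
    (hj : j.val = j'.val) (h : j'.val < k'.val) :
    (y.deg j).face k = (y.face k').deg j' := by
  obtain rfl : k = k'.succ := Fin.ext hk
  obtain rfl : j = j'.castSucc := Fin.ext hj
  exact y.face_deg_of_gt _ _ h

/-- The face identities hold in every simplex. -/
theorem IsSimplex.face_face {𝒱 : Set (Set U)} {n : ℕ} {y : PreSimplex U (n + 2)}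
    (hy : IsSimplex 𝒱 y) (i j : Fin (n + 2)) (h : i ≤ j) :
    (y.face j.succ).face i = (y.face i.castSucc).face j :=
  hy.2.1 i j h

/-- The degeneracies of a simplex satisfy the matching condition. -/
theorem IsSimplex.facesCompatible_deg {𝒱 : Set (Set U)} {n : ℕ} {y : PreSimplex U (n + 1)}
    (hy : IsSimplex 𝒱 y) (j p q : Fin (n + 2)) (hpq : p ≤ q) :
    ((y.deg j).face q.succ).face p = ((y.deg j).face p.castSucc).face q := by
  have hpq' : p.val ≤ q.val := hpq
  rcases lt_trichotomy (q.val + 1) j.val with h | h | h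
  · obtain ⟨n, rfl⟩ : ∃ m, n = m + 1 := ⟨n - 1, by omega⟩
    rw [y.face_deg_left (k := q.succ) ⟨q.val + 1, by omega⟩ ⟨j.val - 1, by omega⟩
        (by simp) (by simp only []; omega) (by simp only []; omega),
      y.face_deg_left (k := p.castSucc) p ⟨j.val - 1, by omega⟩
        (by simp) (by simp only []; omega) (by simp only []; omega),
      PreSimplex.face_deg_left _ ⟨p.val, by omega⟩ ⟨j.val - 2, by omega⟩
        (by simp) (by simp only []; omega) (by simp only []; omega),
      PreSimplex.face_deg_left _ ⟨q.val, by omega⟩ ⟨j.val - 2, by omega⟩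
        (by simp) (by simp only []; omega) (by simp only []; omega)]
    congr 1
    exact hy.face_face ⟨p.val, by omega⟩ ⟨q.val, by omega⟩ hpq
  · rw [y.face_deg_self q.succ j (Or.inl (by simpa using h)),
      y.face_deg_left (k := p.castSucc) p ⟨j.val - 1, by omega⟩
        (by simp) (by simp only []; omega) (by simp only []; omega),
      PreSimplex.face_deg_self _ _ _ (Or.inl (by simp only []; omega))]
  · rcases Nat.lt_or_ge j.val q.val with h1 | h1
    · rcases lt_or_ge p.val j.val with h2 | h2
      · obtain ⟨n, rfl⟩ : ∃ m, n = m + 1 := ⟨n - 1, by omega⟩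
        rw [y.face_deg_right (k := q.succ) q ⟨j.val, by omega⟩ (by simp) (by simp)
            (by simp only []; omega),
          y.face_deg_left (k := p.castSucc) p ⟨j.val - 1, by omega⟩
            (by simp) (by simp only []; omega) (by simp only []; omega),
          PreSimplex.face_deg_left _ ⟨p.val, by omega⟩ ⟨j.val - 1, by omega⟩
            (by simp) (by simp only []; omega) (by simp only []; omega),
          PreSimplex.face_deg_right _ ⟨q.val - 1, by omega⟩ ⟨j.val - 1, by omega⟩
            (by simp only []; omega) (by simp) (by simp only []; omega)]
        congr 1
        have := hy.face_face ⟨p.val, by omega⟩ ⟨q.val - 1, by omega⟩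
          (by simp only [Fin.le_def]; omega)
        have hq : Fin.succ (⟨q.val - 1, by omega⟩ : Fin (n + 2)) = q := by
          ext; simp only [Fin.val_succ]; omega
        rw [hq] at this
        exact this
      · rcases lt_or_ge (j.val + 1) p.val with h3 | h3
        · obtain ⟨n, rfl⟩ : ∃ m, n = m + 1 := ⟨n - 1, by omega⟩
          rw [y.face_deg_right (k := q.succ) q ⟨j.val, by omega⟩ (by simp) (by simp)
              (by simp only []; omega),
            y.face_deg_right (k := p.castSucc) ⟨p.val - 1, by omega⟩ ⟨j.val, by omega⟩
              (by simp only [Fin.val_castSucc]; omega) (by simp) (by simp only []; omega),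
            PreSimplex.face_deg_right _ ⟨p.val - 1, by omega⟩ ⟨j.val, by omega⟩
              (by simp only []; omega) (by simp) (by simp only []; omega),
            PreSimplex.face_deg_right _ ⟨q.val - 1, by omega⟩ ⟨j.val, by omega⟩
              (by simp only []; omega) (by simp) (by simp only []; omega)]
          congr 1
          have := hy.face_face ⟨p.val - 1, by omega⟩ ⟨q.val - 1, by omega⟩
            (by simp only [Fin.le_def]; omega)
          have hq : Fin.succ (⟨q.val - 1, by omega⟩ : Fin (n + 2)) = q := by
            ext; simp only [Fin.val_succ]; omega
          rw [hq] at this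
          exact this
        · rw [y.face_deg_right (k := q.succ) q ⟨j.val, by omega⟩ (by simp) (by simp)
              (by simp only []; omega),
            PreSimplex.face_deg_self _ _ _ (by simp only []; omega),
            y.face_deg_self p.castSucc j (by simp only [Fin.val_castSucc]; omega)]
    · rw [y.face_deg_self q.succ j (Or.inr (by simp only [Fin.val_succ]; omega))]
      rcases lt_or_ge p.val j.val with h2 | h2
      · rw [y.face_deg_left (k := p.castSucc) p ⟨j.val - 1, by omega⟩
            (by simp) (by simp only []; omega) (by simp only []; omega),
          PreSimplex.face_deg_self _ _ _ (Or.inr (by simp only []; omega))]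
      · rw [y.face_deg_self p.castSucc j (Or.inl (by simp only [Fin.val_castSucc]; omega))]
        congr 1
        ext; omega

/-- The degeneracies of a simplex are simplices. -/
theorem IsSimplex.deg {𝒱 : Set (Set U)} : ∀ {n : ℕ} {y : PreSimplex U n}, IsSimplex 𝒱 y →
    ∀ j : Fin (n + 1), IsSimplex 𝒱 (y.deg j)
  | 0, y, hy, j => by
    refine ⟨fun _ => hy, trivial, ?_⟩
    rintro _ ⟨t, ht, rfl⟩ k
    exact ht
  | n + 1, y, hy, j => by
    refine ⟨fun k => ?_, fun p q h => hy.facesCompatible_deg j p q h, ?_⟩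
    · change IsSimplex 𝒱 ((y.deg j).face k)
      rcases degList_cases j k with rfl | rfl | ⟨i, j', h, rfl, rfl⟩ | ⟨i, j', h, rfl, rfl⟩
      · rwa [y.face_castSucc_deg]
      · rwa [y.face_succ_deg]
      · rw [y.face_deg_of_le _ _ h]
        exact IsSimplex.deg (hy.1 i) j'
      · rw [y.face_deg_of_gt _ _ h]
        exact IsSimplex.deg (hy.1 i) j'
    · rintro _ ⟨a, ha, rfl⟩ k
      change arrDeg j a k ∈ ((y.deg j).face k).elem
      rcases degList_cases j k with rfl | rfl | ⟨i, j', h, rfl, rfl⟩ | ⟨i, j', h, rfl, rfl⟩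
      · rw [y.face_castSucc_deg, arrDeg_castSucc]; exact ha
      · rw [y.face_succ_deg, arrDeg_succ]; exact ha
      · rw [y.face_deg_of_le _ _ h, arrDeg_of_le _ _ _ h, PreSimplex.elem_deg]
        exact ⟨a i, hy.2.2 a ha i, rfl⟩
      · rw [y.face_deg_of_gt _ _ h, arrDeg_of_gt _ _ _ h, PreSimplex.elem_deg]
        exact ⟨a i, hy.2.2 a ha i, rfl⟩

/-- The simplicial set `𝒮` of relations on the family `𝒱` of sets. -/
def relationComplex (𝒱 : Set (Set U)) : SimplicialSystem.{u} where
  obj n := {y : PreSimplex U n // IsSimplex 𝒱 y}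
  d j y := ⟨y.1.face j, y.2.1 j⟩
  s j y := ⟨y.1.deg j, y.2.deg j⟩
  d_d y i j h := Subtype.ext (y.2.face_face i j h)
  d_s_of_le y i j h := Subtype.ext (y.1.face_deg_of_le i j h)
  d_s_castSucc y j := Subtype.ext (y.1.face_castSucc_deg j)
  d_s_succ y j := Subtype.ext (y.1.face_succ_deg j)
  d_s_of_gt y i j h := Subtype.ext (y.1.face_deg_of_gt i j h)
  s_s y i j h := Subtype.ext (y.1.deg_deg i j h)

/-- The `n`-simplices of `𝒮`. -/
abbrev Simplex (𝒱 : Set (Set U)) (n : ℕ) : Type u := (relationComplex 𝒱).obj n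

/-- The set of elements (the domain) of a simplex. -/
def Simplex.elem {𝒱 : Set (Set U)} {n : ℕ} (y : Simplex 𝒱 n) : Set (Arr U n) := y.1.elem

/-- The `j`-th face of a simplex. -/
def Simplex.face {𝒱 : Set (Set U)} {n : ℕ} (j : Fin (n + 2)) (y : Simplex 𝒱 (n + 1)) :
    Simplex 𝒱 n := (relationComplex 𝒱).d j y

/-! ### Properties of simplices of `𝒮` -/

/-- `a` is component-simplicial: `e_p e_q a = e_{q-1} e_p a` for all positions `p < q`, where
`e_j a = a j`. (A pair `p < q` is written `p.castSucc`, `q.succ` with `p ≤ q`.) -/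
def ComponentSimplicial {n : ℕ} (a : Arr U (n + 2)) : Prop :=
  ∀ p q : Fin (n + 2), p ≤ q → a q.succ p = a p.castSucc q

variable {𝒱 : Set (Set U)}

/-- `y` is e-simplicial (element-simplicial): all its elements are component-simplicial. The
condition is vacuous in dimensions `0` and `1`. -/
def ESimplicial : ∀ {n : ℕ}, Simplex 𝒱 n → Prop
  | 0, _ => True
  | 1, _ => True
  | _ + 2, y => ∀ a ∈ y.elem, ComponentSimplicial a

/-- `y` is subface-simplicial: `y` and all its iterated faces are e-simplicial. -/
def SubfaceSimplicial : ∀ {n : ℕ}, Simplex 𝒱 n → Prop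
  | 0, y => ESimplicial y
  | _ + 1, y => ESimplicial y ∧ ∀ j, SubfaceSimplicial (y.face j)

/-- `y` is `i`-surjective: `i` is a position of `y` and `e_i : y → d_i y` is surjective. -/
def Surj (i : ℕ) : ∀ {n : ℕ}, Simplex 𝒱 n → Prop
  | 0, _ => False
  | n + 1, y => ∃ h : i < n + 2, ∀ t ∈ (y.face ⟨i, h⟩).elem, ∃ a ∈ y.elem, a ⟨i, h⟩ = t

/-- `b = (b_j)_{j ∈ A}` is an `A`-indexed (component-simplicial) partial element of `y`:
`b_j ∈ d_j y` for `j ∈ A`, and `e_p b_q = e_{q-1} b_p` for all `p < q` in `A`. -/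
def IsPartialElement {n : ℕ} (y : Simplex 𝒱 (n + 2)) (A : Set ℕ)
    (b : {j : Fin (n + 3) // j.val ∈ A} → Arr U (n + 1)) : Prop :=
  (∀ j, b j ∈ (y.face j.1).elem) ∧
    ∀ (p q : Fin (n + 2)) (hp : p.castSucc.val ∈ A) (hq : q.succ.val ∈ A), p ≤ q →
      b ⟨q.succ, hq⟩ p = b ⟨p.castSucc, hp⟩ q

/-- `y` is `A`-determinate (`y` of dimension `n ≥ 2`, `A` a subset of `{0, …, n}`): every
`A`-indexed partial element of `y` extends to an element of `y`. -/
def Determinate (A : Set ℕ) : ∀ {n : ℕ}, Simplex 𝒱 n → Prop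
  | 0, _ => False
  | 1, _ => False
  | n + 2, y => (∀ j ∈ A, j ≤ n + 2) ∧
      ∀ b : {j : Fin (n + 3) // j.val ∈ A} → Arr U (n + 1), IsPartialElement y A b →
        ∃ a ∈ y.elem, ∀ j, a j.1 = b j

/-- The `(n+1)`-simplex `w` is an `(n,i)`-composition (`n ≥ 1`, `0 ≤ i ≤ n + 1`). -/
def IsComposition (i : ℕ) : ∀ {m : ℕ}, Simplex 𝒱 m → Prop
  | 0, _ => False
  | 1, _ => False
  | m + 2, w => ∃ h : i < m + 3,
      ESimplicial w ∧
      -- The partial elements `(b_j)_{j ≠ i}` of `w` have exactly one component-simplicial filler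
      -- `a` each; its `i`-th component is in `d_i w`, and `a` is in `w`.
      (∀ a : Arr U (m + 2), ComponentSimplicial a →
        (∀ j : Fin (m + 3), j.val ≠ i → a j ∈ (w.face j).elem) →
          a ⟨i, h⟩ ∈ (w.face ⟨i, h⟩).elem ∧ a ∈ w.elem) ∧
      ∀ c : Arr U (m + 1), c ∈ (w.face ⟨i, h⟩).elem ↔ ∃ a ∈ w.elem, a ⟨i, h⟩ = c

/-- The conditions on an `n`-simplex `y` in the case `1 < i < n`: it is subface-simplicial,
`i`-surjective, `(i-1)`-surjective and `{i-2, i+1}`-determinate. -/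
def ComposerConditions (i : ℕ) {n : ℕ} (y : Simplex 𝒱 n) : Prop :=
  SubfaceSimplicial y ∧ Surj i y ∧ Surj (i - 1) y ∧ Determinate {i - 2, i + 1} y

/-- The set `Y` of `n`-simplices is saturated: whenever the composite `d_i w` of an
`(n,i)`-composition `w` with factors `d_j w`, `j ≠ i`, in `Y` satisfies the conditions above, it
belongs to `Y`. -/
def Saturated (i : ℕ) {n : ℕ} (Y : Set (Simplex 𝒱 n)) : Prop :=
  ∀ w : Simplex 𝒱 (n + 1), IsComposition i w → (∀ j, j.val ≠ i → w.face j ∈ Y) →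
    ∀ j, j.val = i → ComposerConditions i (w.face j) → w.face j ∈ Y

end SetRelations

namespace SetRelations

variable {U : Type u} {𝒱 : Set (Set U)}

open Function

/-! A component-simplicial array is determined by its vertices once its components are, so an
element of a subface-simplicial simplex is a tuple `x` of vertices and the simplex is a relation on
tuples. The component `e_j` omits the `j`-th vertex. Surjectivity of `e_k` means that a tuple
related by the face opposite `k` becomes related after a change of `x k` (`Lifts`); `{p,
q}`-determinacy means that the faces opposite `p` and `q` alone force the relation (`Fills`). A
composition relates exactly the tuples related by all its faces other than the `i`-th, and that face
is its projection.

The subcomplex is built upwards from dimension `n` by taking compositions. Fillers of horns exist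
and are unique because a composition can be written down from its factors and is determined by them
(`exists_isComposition`, `IsComposition.ext`). The substance is closure under `d_i` and under
degeneracies. The induction carries one property besides the given ones, `Fills (i - 2) i`; in
dimension `n` it follows from determinacy of a degenerate simplex (`fills_of_fills_deg`).

If the factors have these properties, then for a given tuple the relations of faces `i - 2` and `i +
2` imply those of all other factors (`faceRel_of_faceRel_faceRel`). From this the composition
inherits the properties, and its composite `d_i w` satisfies the original conditions
(`IsComposition.composerConditions_face`). In dimension `n`, saturation then puts `d_i w` in the
subcomplex; above it, the conditions make `d_i w` itself a composition. Degeneracies are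
compositions because an index away from `i`, `j`, `j + 1` detects the repeated vertex
(`isComposition_deg`). -/

/-! ### Arrays given by their vertices -/

/-- The increasing map `ℕ → ℕ` which omits the value `j`. -/
def skip (j k : ℕ) : ℕ := if k < j then k else k + 1

/-- The nondecreasing surjection `ℕ → ℕ` which takes the value `j` twice. -/
def collapse (j k : ℕ) : ℕ := if k ≤ j then k else k - 1

/-- The array of dimension `n` with vertices `x_0, …, x_n`. -/
def tup : ∀ {n : ℕ}, (ℕ → U) → Arr U n
  | 0, x => x 0
  | _ + 1, x => fun j => tup (fun k => x (skip j.val k))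

theorem tup_apply {n : ℕ} (x : ℕ → U) (j : Fin (n + 2)) :
    (tup x : Arr U (n + 1)) j = tup (fun k => x (skip j.val k)) := rfl

theorem tup_congr : ∀ {n : ℕ} {x y : ℕ → U}, (∀ k ≤ n, x k = y k) →
    (tup x : Arr U n) = tup y
  | 0, _, _, h => h 0 le_rfl
  | n + 1, x, y, h => by
    funext j
    refine tup_congr fun k hk => h _ ?_
    unfold skip
    split_ifs <;> omega

theorem tup_injective : ∀ {n : ℕ} {x y : ℕ → U}, (tup x : Arr U n) = tup y →
    ∀ k ≤ n, x k = y k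
  | 0, _, _, h, k, hk => by
    obtain rfl : k = 0 := by omega
    exact h
  | n + 1, x, y, h, k, hk => by
    -- The last component still contains vertex 0, and the component 0 contains all the others.
    rcases Nat.eq_zero_or_pos k with rfl | hk0
    · have := tup_injective (congrFun h (Fin.last (n + 1))) 0 (Nat.zero_le _)
      simpa [skip] using this
    · have := tup_injective (congrFun h 0) (k - 1) (by omega)
      simpa [skip, Nat.sub_add_cancel hk0] using this

theorem ComponentSimplicial.apply_apply {n : ℕ} {a : Arr U (n + 2)} (ha : ComponentSimplicial a)
    (p q : Fin (n + 3)) (p' q' : Fin (n + 2)) (h : p.val < q.val) (hp : p'.val = p.val)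
    (hq : q'.val + 1 = q.val) : a q p' = a p q' := by
  obtain rfl : q = q'.succ := Fin.ext (by simp [hq])
  obtain rfl : p = p'.castSucc := Fin.ext (by simp [hp])
  exact ha p' q' (by simp only [Fin.val_castSucc, Fin.val_succ] at h; exact Nat.lt_succ_iff.mp h)

theorem skip_skip {p q : ℕ} (h : p ≤ q) (k : ℕ) :
    skip (q + 1) (skip p k) = skip p (skip q k) := by
  unfold skip
  split_ifs <;> omega

theorem componentSimplicial_tup {n : ℕ} (x : ℕ → U) :
    ComponentSimplicial (tup x : Arr U (n + 2)) := by
  intro p q h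
  refine tup_congr fun k _ => ?_
  simp only [Fin.val_succ, Fin.val_castSucc]
  rw [skip_skip h]

/-- A component-simplicial array is determined by its components other than the `i`-th. -/
theorem ComponentSimplicial.ext_of_ne {n : ℕ} {a b : Arr U (n + 2)} (ha : ComponentSimplicial a)
    (hb : ComponentSimplicial b) (i : ℕ) (h : ∀ j : Fin (n + 3), j.val ≠ i → a j = b j) :
    a = b := by
  funext j
  by_cases hj : j.val = i
  -- By the simplicial identities each component of `a j` is also a component of some `a l` with `l
  -- ≠ j`.
  · funext k
    rcases lt_or_ge k.val j.val with hk | hk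
    · rw [ha.apply_apply ⟨k.val, by omega⟩ j k ⟨j.val - 1, by omega⟩ hk rfl (by simp only []; omega),
        hb.apply_apply ⟨k.val, by omega⟩ j k ⟨j.val - 1, by omega⟩ hk rfl (by simp only []; omega),
        h _ (by simp only []; omega)]
    · rw [← ha.apply_apply j ⟨k.val + 1, by omega⟩ ⟨j.val, by omega⟩ k
          (by simp only []; omega) rfl rfl,
        ← hb.apply_apply j ⟨k.val + 1, by omega⟩ ⟨j.val, by omega⟩ k
          (by simp only []; omega) rfl rfl, h _ (by simp only []; omega)]
  · exact h j hj

/-- Tuples which agree where they overlap can be glued. -/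
theorem exists_glue {n p q : ℕ} (hpq : p < q) (hq : q ≤ n + 1) (u v : ℕ → U)
    (h : ∀ k, k + 1 ≤ n → v (skip p k) = u (skip (q - 1) k)) :
    ∃ x : ℕ → U, (∀ k ≤ n, x (skip p k) = u k) ∧ ∀ k ≤ n, x (skip q k) = v k := by
  -- Entry `p` is missing from `u`, but stands at index `p` of `v` because `p < q`; every other
  -- entry is read from `u`.
  refine ⟨fun k => if k = p then v p else if k < p then u k else u (k - 1), ?_, ?_⟩
  · intro k _
    simp only [skip]
    split_ifs <;> first | omega | rfl
  · intro k hk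
    rcases lt_trichotomy k p with hkp | rfl | hkp
    · have := h k (by omega)
      simp only [skip] at this ⊢
      rw [if_pos hkp, if_pos (by omega)] at this
      rw [this]
      split_ifs <;> first | omega | rfl
    · simp [skip, hpq]
    · have := h (k - 1) (by omega)
      simp only [skip] at this ⊢
      rw [if_neg (by omega), Nat.sub_add_cancel (by omega)] at this
      rw [this]
      split_ifs <;> first | omega | rfl

/-- If all components but the `i`-th of a component-simplicial array are given by tuples, so is
the array. -/
theorem ComponentSimplicial.exists_tup {n : ℕ} {a : Arr U (n + 2)} (ha : ComponentSimplicial a)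
    (i : ℕ) (h : ∀ j : Fin (n + 3), j.val ≠ i → ∃ x : ℕ → U, a j = tup x) :
    ∃ x : ℕ → U, a = tup x := by
  -- There are at least three positions, so two of them differ from `i`; gluing these two components
  -- yields the candidate `x`.
  obtain ⟨p, q, hpq, hq, hpi, hqi⟩ : ∃ p q, p < q ∧ q ≤ n + 2 ∧ p ≠ i ∧ q ≠ i := by
    by_cases h0 : i = 0
    · exact ⟨1, 2, by omega, by omega, by omega, by omega⟩
    · by_cases h1 : i = 1
      · exact ⟨0, 2, by omega, by omega, by omega, by omega⟩
      · exact ⟨0, 1, by omega, by omega, by omega, by omega⟩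
  obtain ⟨u, hu⟩ := h ⟨p, by omega⟩ hpi
  obtain ⟨v, hv⟩ := h ⟨q, by omega⟩ hqi
  obtain ⟨x, hxu, hxv⟩ := exists_glue (n := n + 1) hpq hq u v (by
    intro k hk
    have := ha.apply_apply ⟨p, by omega⟩ ⟨q, by omega⟩ ⟨p, by omega⟩ ⟨q - 1, by omega⟩ hpq rfl
      (by simp only []; omega)
    rw [hu, hv] at this
    exact tup_injective this k (by omega))
  refine ⟨x, ha.ext_of_ne (componentSimplicial_tup x) i fun r hr => ?_⟩
  -- A vertex other than `t` is visible in the component `t`, so if that component comes from `x`,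
  -- the identity relating `a r` to `a t` fixes the vertex in `a r`. Since no vertex is both `p` and
  -- `q`, the cases `t = p` and `t = q` together cover everything.
  have key : ∀ (t : ℕ) (ht : t < n + 3), a ⟨t, ht⟩ = tup (fun k => x (skip t k)) →
      ∀ z : ℕ → U, a r = tup z → ∀ k ≤ n + 1, skip r.val k ≠ t → z k = x (skip r.val k) := by
    intro t ht hat z hz k hk hkt
    rcases lt_trichotomy t r.val with htr | htr | htr
    · have := ha.apply_apply ⟨t, ht⟩ r ⟨t, by omega⟩ ⟨r.val - 1, by omega⟩ htr rfl
        (by simp only []; omega)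
      rw [hat, hz] at this
      have := tup_injective this (if k < t then k else k - 1)
      simp only [skip] at this hkt ⊢
      have hk' : (if (if k < t then k else k - 1) < t then (if k < t then k else k - 1)
          else (if k < t then k else k - 1) + 1) = k := by
        split_ifs at * <;> omega
      rw [hk'] at this
      rw [this (by split_ifs at * <;> omega)]
      congr 1
      split_ifs at * <;> omega
    · subst htr
      rw [hz] at hat
      exact tup_injective hat k hk
    · have := ha.apply_apply r ⟨t, ht⟩ ⟨r.val, by omega⟩ ⟨t - 1, by omega⟩ htr rfl
        (by simp only []; omega)
      rw [hat, hz] at this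
      have := tup_injective this (if k < t - 1 then k else k - 1)
      simp only [skip] at this hkt ⊢
      have hk' : (if (if k < t - 1 then k else k - 1) < t - 1 then (if k < t - 1 then k else k - 1)
          else (if k < t - 1 then k else k - 1) + 1) = k := by
        split_ifs at * <;> omega
      rw [hk'] at this
      rw [← this (by split_ifs at * <;> omega)]
      congr 1
      split_ifs at * <;> omega
  obtain ⟨z, hz⟩ := h r hr
  rw [hz]
  change tup z = tup (fun k => x (skip r.val k))
  refine tup_congr fun k hk => ?_
  by_cases hkp : skip r.val k = p
  · exact key q (by omega) (hv.trans (tup_congr fun k hk => (hxv k hk).symm)) z hz k hk (by omega)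
  · exact key p (by omega) (hu.trans (tup_congr fun k hk => (hxu k hk).symm)) z hz k hk hkp

theorem arrDeg_tup : ∀ {n : ℕ} (j : Fin (n + 1)) (x : ℕ → U),
    arrDeg j (tup x) = tup (fun k => x (collapse j.val k))
  | 0, j, x => by
    funext k
    change x 0 = x _
    congr 1
    simp only [collapse, skip]
    split_ifs <;> omega
  | n + 1, j, x => by
    funext k
    rw [tup_apply]
    rcases degList_cases j k with rfl | rfl | ⟨i, j', h, rfl, rfl⟩ | ⟨i, j', h, rfl, rfl⟩
    · rw [arrDeg_castSucc]
      refine tup_congr fun l _ => congrArg x ?_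
      simp only [collapse, skip, Fin.val_castSucc]
      split_ifs <;> omega
    · rw [arrDeg_succ]
      refine tup_congr fun l _ => congrArg x ?_
      simp only [collapse, skip, Fin.val_succ]
      split_ifs <;> omega
    · have h' : i.val ≤ j'.val := h
      rw [arrDeg_of_le _ _ _ h, tup_apply, arrDeg_tup]
      refine tup_congr fun l _ => congrArg x ?_
      simp only [collapse, skip, Fin.val_succ, Fin.val_castSucc]
      split_ifs <;> omega
    · have h' : j'.val < i.val := h
      rw [arrDeg_of_gt _ _ _ h, tup_apply, arrDeg_tup]
      refine tup_congr fun l _ => congrArg x ?_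
      simp only [collapse, skip, Fin.val_succ, Fin.val_castSucc]
      split_ifs <;> omega

theorem skip_collapse {j k : ℕ} (h : k ≠ j) : skip j (if k < j then k else k - 1) = k := by
  simp only [skip]
  split_ifs <;> omega

theorem collapse_skip (j k : ℕ) : collapse j (skip j k) = k := by
  simp only [skip, collapse]
  split_ifs <;> omega

theorem skip_ne (j k : ℕ) : skip j k ≠ j := by
  unfold skip
  split_ifs <;> omega

theorem skip_injective (j : ℕ) : Injective (skip j) := fun a b h => by
  unfold skip at h
  split_ifs at h <;> omega

/-! ### Simplices as relations on vertices -/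

theorem Simplex.apply_mem_face {n : ℕ} {y : Simplex 𝒱 (n + 1)} {a : Arr U (n + 1)}
    (ha : a ∈ y.elem) (j : Fin (n + 2)) : a j ∈ (y.face j).elem :=
  y.2.2.2 a ha j

/-- The relation on the vertices given by a simplex. -/
def Simplex.Rel {n : ℕ} (y : Simplex 𝒱 n) (x : ℕ → U) : Prop := tup x ∈ y.elem

/-- The vertices other than the `j`-th of `x` are related by the `j`-th face of `y`. -/
def Simplex.FaceRel {n : ℕ} (y : Simplex 𝒱 (n + 1)) (j : ℕ) (x : ℕ → U) : Prop :=
  ∃ h : j < n + 2, (y.face ⟨j, h⟩).Rel fun k => x (skip j k)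

/-- The vertices of `x` other than the `j`-th and the `p`-th are related by the corresponding
face of the `j`-th face of `y`. -/
def Simplex.FaceRel₂ {n : ℕ} (y : Simplex 𝒱 (n + 2)) (j p : ℕ) (x : ℕ → U) : Prop :=
  ∃ h : j < n + 3, (y.face ⟨j, h⟩).FaceRel (if p < j then p else p - 1) fun k => x (skip j k)

/-- Related faces opposite to the vertices `p` and `q` make a related tuple. -/
def Simplex.Fills {n : ℕ} (y : Simplex 𝒱 (n + 1)) (p q : ℕ) : Prop :=
  ∀ x, y.FaceRel p x → y.FaceRel q x → y.Rel x

/-- A related face opposite to the vertex `k` can be completed. -/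
def Simplex.Lifts {n : ℕ} (y : Simplex 𝒱 (n + 1)) (k : ℕ) : Prop :=
  ∀ x, y.FaceRel k x → ∃ t, y.Rel (update x k t)

theorem Simplex.Rel.congr {n : ℕ} {y : Simplex 𝒱 n} {x x' : ℕ → U} (h : y.Rel x)
    (hx : ∀ k ≤ n, x k = x' k) : y.Rel x' := by
  unfold Rel at h ⊢
  rwa [← tup_congr hx]

theorem Simplex.FaceRel.congr {n : ℕ} {y : Simplex 𝒱 (n + 1)} {j : ℕ} {x x' : ℕ → U}
    (h : y.FaceRel j x) (hx : ∀ k ≠ j, x k = x' k) : y.FaceRel j x' :=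
  ⟨h.1, h.2.congr fun _ _ => hx _ (skip_ne _ _)⟩

theorem Simplex.FaceRel₂.congr {n : ℕ} {y : Simplex 𝒱 (n + 2)} {j p : ℕ} {x x' : ℕ → U}
    (h : y.FaceRel₂ j p x) (hjp : p ≠ j) (hx : ∀ k, k ≠ j → k ≠ p → x k = x' k) :
    y.FaceRel₂ j p x' := by
  refine ⟨h.1, h.2.congr fun k hk => hx _ (skip_ne _ _) fun h => hk ?_⟩
  rw [← skip_collapse hjp] at h
  exact skip_injective _ h

theorem Simplex.FaceRel.update {n : ℕ} {y : Simplex 𝒱 (n + 1)} {j : ℕ} {x : ℕ → U}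
    (h : y.FaceRel j x) (t : U) : y.FaceRel j (update x j t) :=
  h.congr fun _ hk => (update_of_ne hk _ _).symm

theorem Simplex.Rel.faceRel {n : ℕ} {y : Simplex 𝒱 (n + 1)} {x : ℕ → U} (h : y.Rel x) {j : ℕ}
    (hj : j < n + 2) : y.FaceRel j x :=
  ⟨hj, apply_mem_face h ⟨j, hj⟩⟩

theorem Simplex.FaceRel.faceRel₂ {n : ℕ} {y : Simplex 𝒱 (n + 2)} {x : ℕ → U} {j : ℕ}
    (h : y.FaceRel j x) {p : ℕ} (hp : p < n + 3) (_ : p ≠ j) : y.FaceRel₂ j p x :=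
  ⟨h.1, h.2.faceRel (by have := h.1; split_ifs <;> omega)⟩

theorem Simplex.face_face {n : ℕ} (y : Simplex 𝒱 (n + 2)) (p q : Fin (n + 3))
    (p' q' : Fin (n + 2)) (h : p.val < q.val) (hp : p'.val = p.val) (hq : q'.val + 1 = q.val) :
    (y.face q).face p' = (y.face p).face q' := by
  obtain rfl : q = q'.succ := Fin.ext (by simp [hq])
  obtain rfl : p = p'.castSucc := Fin.ext (by simp [hp])
  exact (relationComplex 𝒱).d_d y p' q'
    (by simp only [Fin.val_castSucc, Fin.val_succ] at h; exact Nat.lt_succ_iff.mp h)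

/-- This is the identity `d_p d_q = d_{q-1} d_p`. Naming both omitted vertices by their position in
the whole tuple makes it symmetric. -/
theorem Simplex.FaceRel₂.symm {n : ℕ} {y : Simplex 𝒱 (n + 2)} {x : ℕ → U} {j p : ℕ}
    (h : y.FaceRel₂ j p x) (hjp : p ≠ j) : y.FaceRel₂ p j x := by
  obtain ⟨hj, hp, h⟩ := h
  rcases lt_or_gt_of_ne hjp with hlt | hlt
  · simp only [if_pos hlt] at hp h
    refine ⟨by omega, by simp only [if_neg hlt.not_gt]; omega, ?_⟩
    simp only [if_neg hlt.not_gt]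
    rw [← y.face_face ⟨p, _⟩ ⟨j, hj⟩ ⟨p, hp⟩ _ hlt rfl (by simp only []; omega)]
    refine h.congr fun k _ => ?_
    have := skip_skip (p := p) (q := j - 1) (by omega) k
    rw [Nat.sub_add_cancel (by omega)] at this
    rw [this]
  · simp only [if_neg hlt.not_gt] at hp h
    refine ⟨by omega, by simp only [if_pos hlt]; omega, ?_⟩
    simp only [if_pos hlt]
    rw [y.face_face ⟨j, hj⟩ ⟨p, by omega⟩ ⟨j, by omega⟩ ⟨p - 1, hp⟩ hlt rfl (by simp only []; omega)]
    refine h.congr fun k _ => ?_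
    have := skip_skip (p := j) (q := p - 1) (by omega) k
    rw [Nat.sub_add_cancel (by omega)] at this
    rw [this]

theorem Simplex.faceRel₂_skip {n : ℕ} {y : Simplex 𝒱 (n + 2)} {j k : ℕ} (hj : j < n + 3)
    {x : ℕ → U} : y.FaceRel₂ j (skip j k) x ↔
      (y.face ⟨j, hj⟩).FaceRel k fun l => x (skip j l) := by
  have h : (if skip j k < j then skip j k else skip j k - 1) = k := by
    simp only [skip]
    split_ifs <;> omega
  unfold FaceRel₂
  rw [h]
  exact ⟨fun h => h.2, fun h => ⟨hj, h⟩⟩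

/-- Position `p` of the face `j` is vertex `skip j p` of the whole tuple. Nothing is lost in passing
to whole tuples, since `collapse j` is a left inverse of `skip j`. -/
theorem Simplex.fills_face_iff {n : ℕ} {y : Simplex 𝒱 (n + 2)} {j p q : ℕ} (hj : j < n + 3) :
    (y.face ⟨j, hj⟩).Fills p q ↔
      ∀ x, y.FaceRel₂ j (skip j p) x → y.FaceRel₂ j (skip j q) x → y.FaceRel j x := by
  constructor
  · intro h x hp hq
    exact ⟨hj, h _ ((faceRel₂_skip hj).1 hp) ((faceRel₂_skip hj).1 hq)⟩
  · intro h x hp hq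
    have hx : x = fun k => x (collapse j (skip j k)) := by simp only [collapse_skip]
    rw [hx] at hp hq ⊢
    exact (h (fun k => x (collapse j k)) ((faceRel₂_skip hj).2 hp) ((faceRel₂_skip hj).2 hq)).2

theorem Simplex.lifts_face_iff {n : ℕ} {y : Simplex 𝒱 (n + 2)} {j k : ℕ} (hj : j < n + 3) :
    (y.face ⟨j, hj⟩).Lifts k ↔
      ∀ x, y.FaceRel₂ j (skip j k) x → ∃ t, y.FaceRel j (update x (skip j k) t) := by
  have key : ∀ (x : ℕ → U) t, (fun l => update x (skip j k) t (skip j l)) =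
      update (fun l => x (skip j l)) k t := by
    intro x t
    funext l
    by_cases hl : l = k
    · subst hl; simp
    · rw [update_of_ne hl, update_of_ne ((skip_injective j).ne hl)]
  constructor
  · intro h x hk
    obtain ⟨t, ht⟩ := h _ ((faceRel₂_skip hj).1 hk)
    exact ⟨t, hj, by rwa [key]⟩
  · intro h x hk
    have hx : x = fun k => x (collapse j (skip j k)) := by simp only [collapse_skip]
    rw [hx] at hk ⊢
    obtain ⟨t, _, ht⟩ := h (fun k => x (collapse j k)) ((faceRel₂_skip hj).2 hk)
    exact ⟨t, by rwa [key] at ht⟩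

/-- Every element of a subface-simplicial simplex is given by its vertices. -/
theorem SubfaceSimplicial.exists_tup : ∀ {n : ℕ} {y : Simplex 𝒱 n}, SubfaceSimplicial y →
    ∀ a ∈ y.elem, ∃ x : ℕ → U, a = tup x
  | 0, _, _, a, _ => ⟨fun _ => a, rfl⟩
  -- The component 0 omits vertex 0, so it is vertex 1, and vice versa.
  | 1, _, _, a, _ => ⟨fun k => if k = 0 then a 1 else a 0, by
      funext j
      fin_cases j <;> rfl⟩
  | n + 2, _, hy, a, ha =>
    -- The index `n + 3` lies beyond the last position, so no component is exempted.
    (hy.1 a ha).exists_tup (n + 3) fun j _ => (hy.2 j).exists_tup _ (Simplex.apply_mem_face ha j)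

theorem eSimplicial_of_exists_tup {n : ℕ} {y : Simplex 𝒱 n}
    (h : ∀ a ∈ y.elem, ∃ x : ℕ → U, a = tup x) : ESimplicial y := by
  match n, y, h with
  | 0, _, _ => trivial
  | 1, _, _ => trivial
  | n + 2, y, h =>
    intro a ha
    obtain ⟨x, rfl⟩ := h a ha
    exact componentSimplicial_tup x

/-- Elements of the face and of the simplex are both tuples, and a preimage under `e_k` differs from
a given element of the face only by the choice of vertex `k`. -/
theorem surj_iff_lifts {n k : ℕ} {y : Simplex 𝒱 (n + 1)} (hy : SubfaceSimplicial y)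
    (hk : k < n + 2) : Surj k y ↔ y.Lifts k := by
  constructor
  · rintro ⟨_, h⟩ x ⟨_, hx⟩
    obtain ⟨a, ha, hax⟩ := h _ hx
    obtain ⟨z, rfl⟩ := hy.exists_tup a ha
    refine ⟨z k, Simplex.Rel.congr ha fun l hl => ?_⟩
    by_cases hlk : l = k
    · subst hlk; simp
    · rw [update_of_ne hlk]
      have := tup_injective hax (if l < k then l else l - 1) (by split_ifs <;> omega)
      simpa only [skip_collapse hlk] using this
  · intro h
    refine ⟨hk, fun t ht => ?_⟩
    obtain ⟨x, rfl⟩ := (hy.2 _).exists_tup t ht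
    obtain ⟨t, ht⟩ := h (fun l => x (collapse k l)) ⟨hk, by
      simpa only [collapse_skip, Simplex.Rel] using ht⟩
    refine ⟨_, ht, tup_congr fun l _ => ?_⟩
    simp only []
    rw [update_of_ne (skip_ne _ _), collapse_skip]

theorem tup_apply_eq {n : ℕ} {x y : ℕ → U} {j : Fin (n + 2)}
    (h : (tup x : Arr U (n + 1)) j = (tup y : Arr U (n + 1)) j) :
    (tup fun k => x (skip j.val k) : Arr U n) = tup fun k => y (skip j.val k) := h

/-- The matching condition on two components is what lets them be glued to one tuple, and as `p ≠ q`
the two components contain every vertex of it. -/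
theorem determinate_iff_fills {n p q : ℕ} {y : Simplex 𝒱 (n + 2)} (hy : SubfaceSimplicial y)
    (hpq : p < q) (hq : q ≤ n + 2) : Determinate {p, q} y ↔ y.Fills p q := by
  have hA : ∀ j : {j : Fin (n + 3) // j.val ∈ ({p, q} : Set ℕ)},
      j = ⟨⟨p, by omega⟩, Or.inl rfl⟩ ∨ j = ⟨⟨q, by omega⟩, Or.inr rfl⟩ := by
    rintro ⟨⟨j, hj⟩, hj' | hj'⟩
    · left; ext; exact hj'
    · right; ext; exact hj'
  constructor
  · rintro ⟨-, h⟩ x ⟨hp, hxp⟩ ⟨hq, hxq⟩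
    obtain ⟨a, ha, hax⟩ := h (fun j => (tup x : Arr U (n + 2)) j.1)
      ⟨fun j => by
        rcases hA j with rfl | rfl
        · exact hxp
        · exact hxq,
      fun _ _ _ _ h => componentSimplicial_tup x _ _ h⟩
    obtain ⟨z, rfl⟩ := hy.exists_tup a ha
    refine Simplex.Rel.congr ha fun k hk => ?_
    by_cases h : k = p
    -- Vertex `p` is absent from the component `p`; it is read from the component `q`, where its
    -- index is still `p`.
    · have := tup_injective (tup_apply_eq (hax ⟨⟨q, hq⟩, Or.inr rfl⟩)) k (by omega)
      simpa only [skip, if_pos (h ▸ hpq)] using this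
    · have := tup_injective (tup_apply_eq (hax ⟨⟨p, hp⟩, Or.inl rfl⟩)) (if k < p then k else k - 1)
        (by split_ifs <;> omega)
      simpa only [skip_collapse h] using this
  · intro h
    refine ⟨fun j hj => ?_, fun b hb => ?_⟩
    · rcases hj with rfl | rfl <;> omega
    · obtain ⟨u, hu⟩ := (hy.2 _).exists_tup _ (hb.1 ⟨⟨p, by omega⟩, Or.inl rfl⟩)
      obtain ⟨v, hv⟩ := (hy.2 _).exists_tup _ (hb.1 ⟨⟨q, by omega⟩, Or.inr rfl⟩)
      obtain ⟨x, hxu, hxv⟩ := exists_glue (n := n + 1) hpq hq u v (by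
        intro k hk
        have := hb.2 ⟨p, by omega⟩ ⟨q - 1, by omega⟩ (Or.inl rfl)
          (Or.inr (by simp only [Fin.val_succ, Set.mem_singleton_iff]; omega))
          (by simp only [Fin.le_def]; omega)
        have e : (⟨Fin.succ ⟨q - 1, by omega⟩,
            (Or.inr (by simp only [Fin.val_succ, Set.mem_singleton_iff]; omega))⟩ :
            {j : Fin (n + 3) // j.val ∈ ({p, q} : Set ℕ)}) = ⟨⟨q, by omega⟩, Or.inr rfl⟩ := by
          ext; simp only [Fin.val_succ]; omega
        rw [e] at this
        have := (congrFun hv _).symm.trans (this.trans (congrFun hu _))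
        exact tup_injective this k (by omega))
      have hbp := hu.trans (tup_congr fun k hk => (hxu k hk).symm)
      have hbq := hv.trans (tup_congr fun k hk => (hxv k hk).symm)
      refine ⟨tup x, h x ⟨by omega, ?_⟩ ⟨by omega, ?_⟩, fun j => ?_⟩
      · unfold Simplex.Rel
        rw [← hbp]
        exact hb.1 ⟨⟨p, by omega⟩, Or.inl rfl⟩
      · unfold Simplex.Rel
        rw [← hbq]
        exact hb.1 ⟨⟨q, by omega⟩, Or.inr rfl⟩
      · rcases hA j with rfl | rfl
        · exact hbp.symm
        · exact hbq.symm

/-- The conditions in terms of the relation on vertices. -/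
theorem composerConditions_iff {n i : ℕ} {y : Simplex 𝒱 (n + 2)} (hi : 1 < i) (hin : i < n + 2) :
    ComposerConditions i y ↔
      SubfaceSimplicial y ∧ y.Lifts i ∧ y.Lifts (i - 1) ∧ y.Fills (i - 2) (i + 1) := by
  refine and_congr_right fun hy => ?_
  rw [surj_iff_lifts hy (by omega), surj_iff_lifts hy (by omega),
    determinate_iff_fills hy (by omega) (by omega)]

/-! ### Compositions as relations on vertices -/

section Composition

variable {m i : ℕ} {w : Simplex 𝒱 (m + 2)}

/-- If the factors of a composition are subface-simplicial, so are its composite and the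
composition itself. -/
theorem IsComposition.subfaceSimplicial (hw : IsComposition i w)
    (hf : ∀ j : Fin (m + 3), j.val ≠ i → SubfaceSimplicial (w.face j)) :
    SubfaceSimplicial w := by
  obtain ⟨hi, he, -, hc⟩ := hw
  have htup : ∀ a ∈ w.elem, ∃ x : ℕ → U, a = tup x := fun a ha =>
    (he a ha).exists_tup i fun j hj => (hf j hj).exists_tup _ (Simplex.apply_mem_face ha j)
  refine ⟨he, fun j => ?_⟩
  by_cases hj : j.val = i
  · obtain rfl : j = ⟨i, hi⟩ := Fin.ext hj
    refine ⟨eSimplicial_of_exists_tup fun c hc' => ?_, fun k => ?_⟩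
    · obtain ⟨a, ha, rfl⟩ := (hc c).1 hc'
      obtain ⟨x, rfl⟩ := htup a ha
      exact ⟨_, tup_apply x _⟩
    · rcases lt_or_ge k.val i with hk | hk
      -- The faces of the composite are faces of factors, by the simplicial identities.
      · rw [w.face_face ⟨k.val, by omega⟩ ⟨i, hi⟩ k ⟨i - 1, by omega⟩ hk rfl (by simp only []; omega)]
        exact (hf _ (by simp only []; omega)).2 _
      · rw [← w.face_face ⟨i, hi⟩ ⟨k.val + 1, by omega⟩ ⟨i, by omega⟩ k (by simp only []; omega)
          rfl rfl]
        exact (hf _ (by simp only []; omega)).2 _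
  · exact hf j hj

theorem IsComposition.surj (hw : IsComposition i w) : Surj i w := by
  obtain ⟨hi, -, -, hc⟩ := hw
  exact ⟨hi, fun t ht => (hc t).1 ht⟩

theorem IsComposition.rel (hw : IsComposition i w) {x : ℕ → U}
    (hx : ∀ j < m + 3, j ≠ i → w.FaceRel j x) : w.Rel x := by
  obtain ⟨hi, -, hc, -⟩ := hw
  exact (hc (tup x) (componentSimplicial_tup x) fun j hj => (hx j j.2 hj).2).2

theorem isComposition_of_rel (hw : SubfaceSimplicial w) (hs : Surj i w)
    (h : ∀ x, (∀ j < m + 3, j ≠ i → w.FaceRel j x) → w.Rel x) : IsComposition i w := by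
  obtain ⟨hi, hs⟩ := hs
  refine ⟨hi, hw.1, fun a ha haf => ?_, fun c => ⟨hs c, ?_⟩⟩
  · obtain ⟨x, rfl⟩ := ha.exists_tup i fun j hj => (hw.2 j).exists_tup _ (haf j hj)
    have := h x fun j hj hji => ⟨hj, haf ⟨j, hj⟩ hji⟩
    exact ⟨Simplex.apply_mem_face this _, this⟩
  · rintro ⟨a, ha, rfl⟩
    exact Simplex.apply_mem_face ha _

end Composition

/-! ### Degeneracies -/

section Degeneracy

/-- The `j`-th degeneracy of a simplex. -/
def Simplex.deg {n : ℕ} (j : Fin (n + 1)) (y : Simplex 𝒱 n) : Simplex 𝒱 (n + 1) :=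
  (relationComplex 𝒱).s j y

theorem Simplex.elem_deg {n : ℕ} (y : Simplex 𝒱 n) (j : Fin (n + 1)) :
    (y.deg j).elem = arrDeg j '' y.elem :=
  PreSimplex.elem_deg y.1 j

theorem Simplex.face_deg_self {n : ℕ} (y : Simplex 𝒱 n) (k : Fin (n + 2)) (j : Fin (n + 1))
    (h : k.val = j.val ∨ k.val = j.val + 1) : (y.deg j).face k = y :=
  Subtype.ext (y.1.face_deg_self k j h)

theorem Simplex.face_deg_left {n : ℕ} (y : Simplex 𝒱 (n + 1)) {k : Fin (n + 3)}
    {j : Fin (n + 2)} (k' : Fin (n + 2)) (j' : Fin (n + 1)) (hk : k.val = k'.val)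
    (hj : j.val = j'.val + 1) (h : k'.val ≤ j'.val) :
    (y.deg j).face k = (y.face k').deg j' :=
  Subtype.ext (y.1.face_deg_left k' j' hk hj h)

theorem Simplex.face_deg_right {n : ℕ} (y : Simplex 𝒱 (n + 1)) {k : Fin (n + 3)}
    {j : Fin (n + 2)} (k' : Fin (n + 2)) (j' : Fin (n + 1)) (hk : k.val = k'.val + 1)
    (hj : j.val = j'.val) (h : j'.val < k'.val) :
    (y.deg j).face k = (y.face k').deg j' :=
  Subtype.ext (y.1.face_deg_right k' j' hk hj h)

theorem Simplex.face_deg_cases {n : ℕ} (y : Simplex 𝒱 (n + 1)) (k : Fin (n + 3))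
    (j : Fin (n + 2)) : (y.deg j).face k = y ∨
      ∃ (k' : Fin (n + 2)) (j' : Fin (n + 1)), (y.deg j).face k = (y.face k').deg j' := by
  rcases lt_or_ge k.val j.val with h | h
  · exact Or.inr ⟨⟨k.val, by omega⟩, ⟨j.val - 1, by omega⟩,
      y.face_deg_left _ _ rfl (by simp only []; omega) (by simp only []; omega)⟩
  · rcases lt_or_ge (j.val + 1) k.val with h' | h'
    · exact Or.inr ⟨⟨k.val - 1, by omega⟩, ⟨j.val, by omega⟩,
        y.face_deg_right _ _ (by simp only []; omega) rfl (by simp only []; omega)⟩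
    · exact Or.inl (y.face_deg_self k j (by omega))

theorem SubfaceSimplicial.deg : ∀ {n : ℕ} {y : Simplex 𝒱 n}, SubfaceSimplicial y →
    ∀ j : Fin (n + 1), SubfaceSimplicial (y.deg j) := by
  have he : ∀ {n : ℕ} {y : Simplex 𝒱 n}, SubfaceSimplicial y → ∀ j : Fin (n + 1),
      ESimplicial (y.deg j) := by
    intro n y hy j
    refine eSimplicial_of_exists_tup fun a ha => ?_
    rw [y.elem_deg] at ha
    obtain ⟨b, hb, rfl⟩ := ha
    obtain ⟨x, rfl⟩ := hy.exists_tup b hb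
    exact ⟨_, arrDeg_tup j x⟩
  intro n
  induction n with
  | zero => exact fun hy j => ⟨he hy j, fun k => hy⟩
  | succ n ih =>
    intro y hy j
    refine ⟨he hy j, fun k => ?_⟩
    rcases y.face_deg_cases k j with h | ⟨k', j', h⟩
    · rwa [h]
    · rw [h]
      exact ih (hy.2 k') j'

/-- On tuples `c_j` repeats the `j`-th vertex, by `arrDeg_tup`. -/
theorem Simplex.rel_deg_iff {n : ℕ} {y : Simplex 𝒱 n} (hy : SubfaceSimplicial y)
    {j : Fin (n + 1)} {x : ℕ → U} :
    (y.deg j).Rel x ↔ x j = x (j + 1) ∧ y.Rel fun k => x (skip j k) := by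
  unfold Rel
  rw [y.elem_deg]
  constructor
  · rintro ⟨a, ha, hax⟩
    obtain ⟨z, rfl⟩ := hy.exists_tup a ha
    rw [arrDeg_tup] at hax
    have hz := tup_injective hax
    have h1 := hz j (by omega)
    have h2 := hz (j + 1) (by omega)
    simp only [collapse, le_refl, if_true, Nat.not_succ_le_self, if_false, Nat.add_sub_cancel]
      at h1 h2
    refine ⟨h1.symm.trans h2, Rel.congr ha fun k hk => ?_⟩
    rw [← hz (skip j k) (by unfold skip; split_ifs <;> omega), collapse_skip]
  · rintro ⟨hj, h⟩
    refine ⟨_, h, ?_⟩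
    rw [arrDeg_tup]
    refine tup_congr fun k _ => ?_
    rcases lt_trichotomy k j.val with hk | rfl | hk
    · congr 1
      simp only [skip, collapse]
      split_ifs <;> omega
    · simp only [skip, collapse, le_refl, if_true, lt_irrefl, if_false]
      exact hj.symm
    · congr 1
      simp only [skip, collapse]
      split_ifs <;> omega

theorem Simplex.faceRel_deg_self {n : ℕ} {y : Simplex 𝒱 n} {j : Fin (n + 1)} {k : ℕ}
    (hk : k = j.val ∨ k = j.val + 1) {x : ℕ → U} :
    (y.deg j).FaceRel k x ↔ y.Rel fun l => x (skip k l) := by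
  have hk' : k < n + 2 := by omega
  unfold FaceRel
  rw [exists_prop_of_true hk', y.face_deg_self _ j hk]

theorem Simplex.faceRel_deg_iff {n : ℕ} {y : Simplex 𝒱 (n + 1)} (hy : SubfaceSimplicial y)
    {j : Fin (n + 2)} {k : ℕ} (hk : k < n + 3) (hkj : k ≠ j) (hkj' : k ≠ j + 1) {x : ℕ → U} :
    (y.deg j).FaceRel k x ↔
      x j = x (j + 1) ∧ y.FaceRel (if k < j then k else k - 1) fun l => x (skip j l) := by
  unfold FaceRel
  rw [exists_prop_of_true hk]
  rcases lt_or_gt_of_ne hkj with h | h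
  · simp only [if_pos h]
    rw [exists_prop_of_true (by omega : k < n + 2),
      y.face_deg_left (k := ⟨k, hk⟩) ⟨k, by omega⟩ ⟨j - 1, by omega⟩ rfl
      (by simp only []; omega) (by simp only []; omega), rel_deg_iff (hy.2 _)]
    refine and_congr ?_ ?_
    · simp only [skip]
      rw [if_neg (by omega), if_neg (by omega), Nat.sub_add_cancel (by omega)]
    · simp only []
      have : ∀ l, skip k (skip (j - 1) l) = skip j (skip k l) := fun l => by
        rw [← skip_skip (by omega), Nat.sub_add_cancel (by omega)]
      simp only [this]
  · simp only [if_neg h.not_gt]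
    rw [exists_prop_of_true (by omega : k - 1 < n + 2),
      y.face_deg_right (k := ⟨k, hk⟩) ⟨k - 1, by omega⟩ ⟨j, by omega⟩ (by simp only []; omega)
      rfl (by simp only []; omega), rel_deg_iff (hy.2 _)]
    refine and_congr ?_ ?_
    · simp only [skip]
      rw [if_pos (by omega), if_pos (by omega)]
    · simp only []
      have : ∀ l, skip k (skip j l) = skip j (skip (k - 1) l) := fun l => by
        rw [← skip_skip (q := k - 1) (by omega), Nat.sub_add_cancel (by omega)]
      simp only [this]

/-- If `i` is `j` or `j + 1`, the missing vertex is a copy of its twin. Otherwise the face is a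
degeneracy of `d_i y` or of `d_{i-1} y`, according to the side of `j` on which `i` lies; this is
where `(i-1)`-surjectivity is needed. -/
theorem Simplex.lifts_deg {n i : ℕ} {y : Simplex 𝒱 (n + 1)} (hy : SubfaceSimplicial y)
    (hin : i < n + 3) (h : y.Lifts i) (h' : y.Lifts (i - 1)) (j : Fin (n + 2)) :
    (y.deg j).Lifts i := by
  intro x hx
  by_cases hij : i = j
  · rw [faceRel_deg_self (Or.inl hij), hij] at hx
    refine ⟨x (j + 1), (rel_deg_iff hy).2 ⟨?_, hx.congr fun k _ => ?_⟩⟩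
    · rw [hij, update_self, update_of_ne (by omega)]
    · rw [hij, update_of_ne (skip_ne _ _)]
  by_cases hij' : i = j + 1
  · rw [faceRel_deg_self (Or.inr hij'), hij'] at hx
    refine ⟨x j, (rel_deg_iff hy).2 ⟨?_, hx.congr fun k _ => ?_⟩⟩
    · rw [hij', update_self, update_of_ne (by omega)]
    · rw [hij']
      by_cases hk : k = j
      · simp [skip, hk]
      · have e : skip j k = skip (j + 1) k := by
          simp only [skip]
          split_ifs <;> omega
        rw [e, update_of_ne (skip_ne _ _)]
  · rw [faceRel_deg_iff hy hin hij hij'] at hx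
    have hlift : y.Lifts (if i < j then i else i - 1) := by split_ifs <;> assumption
    obtain ⟨t, ht⟩ := hlift _ hx.2
    refine ⟨t, (rel_deg_iff hy).2 ⟨?_, ht.congr fun k _ => ?_⟩⟩
    · rw [update_of_ne (Ne.symm hij), update_of_ne (Ne.symm hij'), hx.1]
    · by_cases hk : k = if i < j then i else i - 1
      · rw [hk, skip_collapse hij, update_self, update_self]
      · rw [update_of_ne hk, update_of_ne]
        intro h
        rw [← skip_collapse hij] at h
        exact hk (skip_injective _ h)

/-- Degeneracies are compositions. -/
theorem isComposition_deg {n i : ℕ} {y : Simplex 𝒱 (n + 2)} (hy : SubfaceSimplicial y)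
    (hin : i < n + 4) (h : y.Lifts i) (h' : y.Lifts (i - 1)) (j : Fin (n + 3)) :
    IsComposition i (y.deg j) := by
  refine isComposition_of_rel (hy.deg j)
    ((surj_iff_lifts (hy.deg j) hin).2 (Simplex.lifts_deg hy hin h h' j)) fun x hx => ?_
  -- There are at least four positions. A face away from `j` and `j + 1` is itself degenerate, so it
  -- forces the vertices `j` and `j + 1` to agree.
  obtain ⟨k, hk, hki, hkj, hkj'⟩ : ∃ k < n + 4, k ≠ i ∧ k ≠ j ∧ k ≠ j + 1 := by
    by_cases h0 : 0 ≠ i ∧ 0 ≠ j.val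
    · exact ⟨0, by omega⟩
    by_cases h1 : 1 ≠ i ∧ 1 ≠ j.val ∧ 1 ≠ j.val + 1
    · exact ⟨1, by omega⟩
    by_cases h2 : 2 ≠ i ∧ 2 ≠ j.val ∧ 2 ≠ j.val + 1
    · exact ⟨2, by omega⟩
    · exact ⟨3, by omega⟩
  have hxj := ((Simplex.faceRel_deg_iff hy hk hkj hkj').1 (hx k hk hki)).1
  refine (Simplex.rel_deg_iff hy).2 ⟨hxj, ?_⟩
  -- The faces `j` and `j + 1` are both `y`, and at least one of them is not the omitted face `i`.
  by_cases hij : j.val = i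
  · have := hx (j + 1) (by omega) (by omega)
    rw [Simplex.faceRel_deg_self (Or.inr rfl)] at this
    refine this.congr fun l _ => ?_
    by_cases hl : l = j
    · subst hl
      simp [skip, hxj]
    · congr 1
      simp only [skip]
      split_ifs <;> omega
  · exact (Simplex.faceRel_deg_self (Or.inl rfl)).1 (hx j (by omega) hij)

end Degeneracy

/-! ### The conditions carried through the induction -/

/-- The inductive form of the conditions on the simplices of the subcomplex. -/
structure StrongConditions (i : ℕ) {n : ℕ} (y : Simplex 𝒱 (n + 1)) : Prop where
  subfaceSimplicial : SubfaceSimplicial y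
  lifts : y.Lifts i
  lifts_pred : y.Lifts (i - 1)
  fills : y.Fills (i - 2) (i + 1)
  fills' : y.Fills (i - 2) i

/-- Put `z = d_{i+1} y`. In `s_{i-1} z` the faces `i - 2` and `i + 1` are degeneracies of `d_{i-2}
z` and `d_i z`, so the hypothesis on `s_{i-1} z` is about filling `z` from its faces `i - 2` and
`i`. Hence the faces `i - 2` and `i` of `y` force the face `i + 1`, and then `h` applies. -/
theorem fills_of_fills_deg {n i : ℕ} (hi : 1 < i) (hin : i < n + 2) {y : Simplex 𝒱 (n + 2)}
    (hy : SubfaceSimplicial y) (h : y.Fills (i - 2) (i + 1))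
    (hdeg : ((y.face ⟨i + 1, by omega⟩).deg ⟨i - 1, by omega⟩).Fills (i - 2) (i + 1)) :
    y.Fills (i - 2) i := by
  have hz : (y.face ⟨i + 1, by omega⟩).Fills (i - 2) i := by
    intro x hx hx'
    have e : (fun l => x (collapse (i - 1) (skip (i - 1) l))) = x := by simp only [collapse_skip]
    have hxi : x (collapse (i - 1) (i - 1)) = x (collapse (i - 1) (i - 1 + 1)) := by
      simp [collapse]
    -- Repeating vertex `i - 1` of `x` gives a tuple to which the degenerate simplex applies.
    have := hdeg (fun l => x (collapse (i - 1) l))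
      ((Simplex.faceRel_deg_iff (hy.2 _) (by omega) (by simp only []; omega)
        (by simp only []; omega)).2 ⟨hxi, by
          simp only [if_pos (by omega : i - 2 < i - 1)]
          rwa [e]⟩)
      ((Simplex.faceRel_deg_iff (hy.2 _) (by omega) (by simp only []; omega)
        (by simp only []; omega)).2 ⟨hxi, by
          simp only [if_neg (by omega : ¬ i + 1 < i - 1), Nat.add_sub_cancel]
          rwa [e]⟩)
    have := ((Simplex.rel_deg_iff (hy.2 _)).1 this).2
    simp only [] at this
    rwa [e] at this
  rw [Simplex.fills_face_iff, show skip (i + 1) (i - 2) = i - 2 from if_pos (by omega),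
    show skip (i + 1) i = i from if_pos (by omega)] at hz
  exact fun x hx hx' => h x hx
    (hz x ((hx.faceRel₂ (by omega) (by omega)).symm (by omega))
      ((hx'.faceRel₂ (by omega) (by omega)).symm (by omega)))

section Factors

variable {m i : ℕ} {w : Simplex 𝒱 (m + 3)}

/-- Restricting the faces `p'` and `q'` to their intersections with the face `j` supplies what
filling inside that face requires. -/
theorem Simplex.FaceRel.faceRel_of_fills {j p q p' q' : ℕ} (hj : j < m + 4)
    (h : (w.face ⟨j, hj⟩).Fills p q) (hp : skip j p = p') (hq : skip j q = q')
    (hp' : p' < m + 4) (hq' : q' < m + 4) {x : ℕ → U} (hxp : w.FaceRel p' x)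
    (hxq : w.FaceRel q' x) : w.FaceRel j x := by
  subst hp hq
  exact (fills_face_iff hj).1 h x ((hxp.faceRel₂ hj (skip_ne _ _).symm).symm (skip_ne _ _).symm)
    ((hxq.faceRel₂ hj (skip_ne _ _).symm).symm (skip_ne _ _).symm)

theorem Simplex.FaceRel₂.exists_faceRel_update {j k k' : ℕ} {x : ℕ → U}
    (hx : w.FaceRel₂ k' j x) (hj : j < m + 4) (h : (w.face ⟨j, hj⟩).Lifts k)
    (hk : skip j k = k') : ∃ t, w.FaceRel j (update x k' t) := by
  subst hk
  exact (lifts_face_iff hj).1 h x (hx.symm (skip_ne _ _).symm)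

theorem Simplex.FaceRel₂.update_left {j p : ℕ} {x : ℕ → U} (h : w.FaceRel₂ j p x)
    (hjp : p ≠ j) (t : U) : w.FaceRel₂ j p (update x j t) :=
  h.congr hjp fun _ hk _ => (update_of_ne hk _ _).symm

variable (hi : 1 < i) (hin : i < m + 2)
  (H : ∀ (j : ℕ) (hj : j < m + 4), j ≠ i → StrongConditions i (w.face ⟨j, hj⟩))

include hi hin H

/-- In whole-tuple indices, `Fills (i - 2) (i + 1)` for the face `j` uses the pair `(i-2, i+2)` if
`j` is `i - 1` or `i + 1`, the pair `(i-1, i+2)` if `j ≤ i - 2`, and the pair `(i-2, i+1)` if `j ≥ i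
+ 2`. So the faces `i - 1` and `i + 1` come first and the rest follow. -/
theorem faceRel_of_faceRel_faceRel {x : ℕ → U} (h : w.FaceRel (i - 2) x)
    (h' : w.FaceRel (i + 2) x) : ∀ j < m + 4, j ≠ i → w.FaceRel j x := by
  have hpred : w.FaceRel (i - 1) x :=
    h.faceRel_of_fills (by omega) (H (i - 1) (by omega) (by omega)).fills
      (if_pos (by omega)) (if_neg (by omega)) (by omega) (by omega) h'
  have hsucc : w.FaceRel (i + 1) x :=
    h.faceRel_of_fills (by omega) (H (i + 1) (by omega) (by omega)).fills
      (if_pos (by omega)) (if_neg (by omega)) (by omega) (by omega) h'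
  intro j hj hji
  rcases lt_or_ge j (i - 1) with hj1 | hj1
  · rcases eq_or_ne j (i - 2) with rfl | hj2
    · exact h
    · exact hpred.faceRel_of_fills hj (H j hj hji).fills
        (by rw [skip, if_neg (by omega)]; omega) (if_neg (by omega)) (by omega) (by omega) h'
  · rcases eq_or_ne j (i - 1) with rfl | hj2
    · exact hpred
    rcases eq_or_ne j (i + 1) with rfl | hj3
    · exact hsucc
    rcases eq_or_ne j (i + 2) with rfl | hj4
    · exact h'
    · exact h.faceRel_of_fills hj (H j hj hji).fills (if_pos (by omega)) (if_pos (by omega))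
        (by omega) (by omega) hsucc

/-- The face `i + 2` is filled from `(i-2, i)` or from `(i-2, i+1)`; the former is where `fills'`
enters. -/
theorem faceRel_of_faceRel_pred {x : ℕ → U} (h : w.FaceRel (i - 2) x)
    (h' : w.FaceRel i x ∨ w.FaceRel (i + 1) x) : ∀ j < m + 4, j ≠ i → w.FaceRel j x := by
  have H2 := H (i + 2) (by omega) (by omega)
  refine faceRel_of_faceRel_faceRel hi hin H h ?_
  rcases h' with h' | h'
  · exact h.faceRel_of_fills (by omega) H2.fills' (if_pos (by omega)) (if_pos (by omega))
      (by omega) (by omega) h'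
  · exact h.faceRel_of_fills (by omega) H2.fills (if_pos (by omega)) (if_pos (by omega))
      (by omega) (by omega) h'

/-- The new vertex is found inside the face `i + 2`; the face `i - 2` is then filled from `i - 1`
and `i + 2`. -/
theorem exists_update_of_faceRel_pred {x : ℕ → U} (h : w.FaceRel (i - 1) x) :
    ∃ t, ∀ j < m + 4, j ≠ i → w.FaceRel j (update x (i - 1) t) := by
  obtain ⟨t, ht⟩ := (h.faceRel₂ (p := i + 2) (by omega) (by omega)).exists_faceRel_update
    (by omega) (H (i + 2) (by omega) (by omega)).lifts_pred (if_pos (by omega))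
  refine ⟨t, faceRel_of_faceRel_faceRel hi hin H ?_ ht⟩
  exact (h.update t).faceRel_of_fills (by omega) (H (i - 2) (by omega) (by omega)).fills
    (by rw [skip, if_neg (by omega)]; omega) (if_neg (by omega)) (by omega) (by omega) ht

/-- The new vertex is found inside the face `i - 2`, whose position `i` is vertex `i + 1`. -/
theorem exists_update_of_faceRel_succ {x : ℕ → U} (h : w.FaceRel (i + 1) x) :
    ∃ t, ∀ j < m + 4, j ≠ i → w.FaceRel j (update x (i + 1) t) := by
  obtain ⟨t, ht⟩ := (h.faceRel₂ (p := i - 2) (by omega) (by omega)).exists_faceRel_update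
    (by omega) (H (i - 2) (by omega) (by omega)).lifts (if_neg (by omega))
  exact ⟨t, faceRel_of_faceRel_pred hi hin H ht (Or.inr (h.update t))⟩

/-- The new vertex `i` is found inside the face `i - 2`, at its position `i - 1`. Only intersections
with the face `i` are known, yet they suffice to fill the face `i + 2` by `fills'`. -/
theorem exists_update_of_faceRel₂ {x : ℕ → U} (h : w.FaceRel₂ i (i - 2) x)
    (h' : w.FaceRel₂ i (i + 2) x) : ∃ t, ∀ j < m + 4, j ≠ i → w.FaceRel j (update x i t) := by
  obtain ⟨t, ht⟩ := h.exists_faceRel_update (k := i - 1)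
    (by omega) (H (i - 2) (by omega) (by omega)).lifts_pred
      (by rw [skip, if_neg (by omega)]; omega)
  refine ⟨t, faceRel_of_faceRel_faceRel hi hin H ht ?_⟩
  have := (Simplex.fills_face_iff (by omega)).1 (H (i + 2) (by omega) (by omega)).fills'
    (update x i t)
  rw [show skip (i + 2) (i - 2) = i - 2 from if_pos (by omega),
    show skip (i + 2) i = i from if_pos (by omega)] at this
  exact this ((ht.faceRel₂ (by omega) (by omega)).symm (by omega))
    ((h'.update_left (by omega) t).symm (by omega))

end Factors

section Composition

variable {m i : ℕ} {w : Simplex 𝒱 (m + 3)}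

theorem IsComposition.lifts (hw : IsComposition i w)
    (hf : ∀ j : Fin (m + 4), j.val ≠ i → SubfaceSimplicial (w.face j)) : w.Lifts i :=
  (surj_iff_lifts (hw.subfaceSimplicial hf) hw.1).1 hw.surj

variable (hi : 1 < i) (hin : i < m + 2)
  (H : ∀ (j : ℕ) (hj : j < m + 4), j ≠ i → StrongConditions i (w.face ⟨j, hj⟩))
  (hw : IsComposition i w)

include hi hin H hw

theorem IsComposition.strongConditions : StrongConditions i w where
  subfaceSimplicial := hw.subfaceSimplicial fun j hj => (H j j.2 hj).subfaceSimplicial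
  lifts := hw.lifts fun j hj => (H j j.2 hj).subfaceSimplicial
  lifts_pred _ hx := (exists_update_of_faceRel_pred hi hin H hx).imp fun _ => hw.rel
  fills _ hx hx' := hw.rel (faceRel_of_faceRel_pred hi hin H hx (Or.inr hx'))
  fills' _ hx hx' := hw.rel (faceRel_of_faceRel_pred hi hin H hx (Or.inl hx'))

/-- The composite of a composition satisfies the conditions, if its factors do. -/
theorem IsComposition.composerConditions_face (j : Fin (m + 4)) (hj : j.val = i) :
    ComposerConditions i (w.face j) := by
  rw [show j = ⟨i, by omega⟩ from Fin.ext hj]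
  have hsub := hw.subfaceSimplicial fun j hj => (H j j.2 hj).subfaceSimplicial
  refine (composerConditions_iff hi hin).2 ⟨hsub.2 _, ?_, ?_, ?_⟩
  · refine (Simplex.lifts_face_iff (by omega)).2 fun x hx => ?_
    rw [show skip i i = i + 1 from if_neg (by omega)] at hx ⊢
    -- Vertex `i` is not part of the face `i`, so it may be chosen freely: first it is chosen to
    -- make the face `i + 1` related, then vertex `i + 1` is adjusted.
    obtain ⟨t, ht⟩ := hx.exists_faceRel_update (j := i + 1) (k := i) (by omega)
      (H (i + 1) (by omega) (by omega)).lifts (if_pos (by omega))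
    obtain ⟨s, hs⟩ := exists_update_of_faceRel_succ hi hin H ht
    refine ⟨s, ((hw.rel hs).faceRel (j := i) (by omega)).congr fun k hk => ?_⟩
    rw [update_comm (by omega), update_of_ne hk]
  · refine (Simplex.lifts_face_iff (by omega)).2 fun x hx => ?_
    rw [show skip i (i - 1) = i - 1 from if_pos (by omega)] at hx ⊢
    obtain ⟨t, ht⟩ := hx.exists_faceRel_update (j := i - 1) (k := i - 1) (by omega)
      (H (i - 1) (by omega) (by omega)).lifts_pred (by rw [skip, if_neg (by omega)]; omega)
    obtain ⟨s, hs⟩ := exists_update_of_faceRel_pred hi hin H ht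
    refine ⟨s, ((hw.rel hs).faceRel (j := i) (by omega)).congr fun k hk => ?_⟩
    rw [update_comm (by omega), update_of_ne hk]
  · refine (Simplex.fills_face_iff (by omega)).2 fun x hx hx' => ?_
    rw [show skip i (i - 2) = i - 2 from if_pos (by omega)] at hx
    rw [show skip i (i + 1) = i + 2 from if_neg (by omega)] at hx'
    obtain ⟨t, ht⟩ := exists_update_of_faceRel₂ hi hin H hx hx'
    exact ((hw.rel ht).faceRel (by omega)).congr fun k hk => update_of_ne hk _ _

end Composition

/-! ### Uniqueness and existence of compositions -/

theorem Simplex.ext {n : ℕ} {y z : Simplex 𝒱 (n + 1)} (h : ∀ j, y.face j = z.face j)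
    (he : y.elem = z.elem) : y = z :=
  Subtype.ext (Prod.ext (funext fun j => congrArg Subtype.val (h j)) he)

/-- A composition is determined by its factors. -/
theorem IsComposition.ext {m i : ℕ} {w z : Simplex 𝒱 (m + 2)} (hw : IsComposition i w)
    (hz : IsComposition i z) (h : ∀ j, j.val ≠ i → w.face j = z.face j) : w = z := by
  obtain ⟨hi, hwe, hwf, hwi⟩ := hw
  obtain ⟨_, hze, hzf, hzi⟩ := hz
  have he : w.elem = z.elem := Set.ext fun a =>
    ⟨fun ha => (hzf a (hwe a ha) fun j hj => h j hj ▸ Simplex.apply_mem_face ha j).2,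
      fun ha => (hwf a (hze a ha) fun j hj => h j hj ▸ Simplex.apply_mem_face ha j).2⟩
  refine Simplex.ext (fun j => ?_) he
  by_cases hj : j.val = i
  · obtain rfl : j = ⟨i, hi⟩ := Fin.ext hj
    refine Simplex.ext (fun k => ?_) (Set.ext fun c => by rw [hwi, hzi, he])
    rcases lt_or_ge k.val i with hk | hk
    · rw [w.face_face ⟨k.val, by omega⟩ ⟨i, hi⟩ k ⟨i - 1, by omega⟩ hk rfl (by simp only []; omega),
        z.face_face ⟨k.val, by omega⟩ ⟨i, hi⟩ k ⟨i - 1, by omega⟩ hk rfl (by simp only []; omega),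
        h _ (by simp only []; omega)]
    · rw [← w.face_face ⟨i, hi⟩ ⟨k.val + 1, by omega⟩ ⟨i, by omega⟩ k (by simp only []; omega)
          rfl rfl,
        ← z.face_face ⟨i, hi⟩ ⟨k.val + 1, by omega⟩ ⟨i, by omega⟩ k (by simp only []; omega)
          rfl rfl, h _ (by simp only []; omega)]
  · exact h j hj

/-- The simplex with given faces and elements. -/
def Simplex.mk {n : ℕ} (F : Fin (n + 3) → Simplex 𝒱 (n + 1)) (E : Set (Arr U (n + 2)))
    (hF : ∀ p q : Fin (n + 2), p ≤ q → (F q.succ).face p = (F p.castSucc).face q)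
    (hE : ∀ a ∈ E, ∀ j, a j ∈ (F j).elem) : Simplex 𝒱 (n + 2) :=
  ⟨(fun j => (F j).1, E), fun j => (F j).2, fun p q h => congrArg Subtype.val (hF p q h), hE⟩

/-- A matching family of factors has a composition. -/
theorem exists_isComposition {m i : ℕ} (hi : i < m + 4) (F : Fin (m + 4) → Simplex 𝒱 (m + 2))
    (hF : ∀ (p q : Fin (m + 4)) (p' q' : Fin (m + 3)), p.val ≠ i → q.val ≠ i → p.val < q.val →
      p'.val = p.val → q'.val + 1 = q.val → (F q).face p' = (F p).face q') :
    ∃ w : Simplex 𝒱 (m + 3), IsComposition i w ∧ ∀ j, j.val ≠ i → w.face j = F j := by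
  -- The definition of a composition forces its elements to be all component-simplicial arrays with
  -- components in the factors.
  set E : Set (Arr U (m + 3)) :=
    {a | ComponentSimplicial a ∧ ∀ j : Fin (m + 4), j.val ≠ i → a j ∈ (F j).elem} with hE
  -- The faces of the composite are forced by the face identities.
  let G : Fin (m + 3) → Simplex 𝒱 (m + 1) := fun k =>
    if hk : k.val < i then (F ⟨k.val, by omega⟩).face ⟨i - 1, by omega⟩
    else (F ⟨k.val + 1, by omega⟩).face ⟨i, by omega⟩
  have hG1 : ∀ (k : ℕ) (hk : k < m + 3) (h : k < i),
      G ⟨k, hk⟩ = (F ⟨k, by omega⟩).face ⟨i - 1, by omega⟩ := fun k hk h => dif_pos h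
  have hG2 : ∀ (k : ℕ) (hk : k < m + 3) (h : ¬ k < i),
      G ⟨k, hk⟩ = (F ⟨k + 1, by omega⟩).face ⟨i, by omega⟩ := fun k hk h => dif_neg h
  let y : Simplex 𝒱 (m + 2) := Simplex.mk G ((fun a => a ⟨i, hi⟩) '' E) (by
      rintro ⟨p, hp⟩ ⟨q, hq⟩ hpq
      have hpq : p ≤ q := hpq
      simp only [Fin.succ_mk, Fin.castSucc_mk]
      rcases lt_or_ge (q + 1) i with h | h
      · rw [hG1 (q + 1) (by omega) h, hG1 p (by omega) (by omega),
          (F _).face_face ⟨p, by omega⟩ ⟨i - 1, by omega⟩ ⟨p, hp⟩ ⟨i - 2, by omega⟩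
            (by simp only []; omega) rfl (by simp only []; omega),
          (F _).face_face ⟨q, by omega⟩ ⟨i - 1, by omega⟩ ⟨q, hq⟩ ⟨i - 2, by omega⟩
            (by simp only []; omega) rfl (by simp only []; omega),
          hF ⟨p, by omega⟩ ⟨q + 1, by omega⟩ ⟨p, by omega⟩ ⟨q, by omega⟩ (by simp only []; omega)
            (by simp only []; omega) (by simp only []; omega) rfl rfl]
      · rw [hG2 (q + 1) (by omega) (by omega)]
        rcases lt_or_ge p i with h' | h'
        · rw [hG1 p (by omega) h',
            (F _).face_face ⟨p, by omega⟩ ⟨i, by omega⟩ ⟨p, hp⟩ ⟨i - 1, by omega⟩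
              (by simp only []; omega) rfl (by simp only []; omega),
            hF ⟨p, by omega⟩ ⟨q + 1 + 1, by omega⟩ ⟨p, by omega⟩ ⟨q + 1, by omega⟩
              (by simp only []; omega) (by simp only []; omega) (by simp only []; omega) rfl rfl,
            (F _).face_face ⟨i - 1, by omega⟩ ⟨q + 1, by omega⟩ ⟨i - 1, by omega⟩ ⟨q, by omega⟩
              (by simp only []; omega) rfl rfl]
        · rw [hG2 p (by omega) (by omega),
            ← (F _).face_face ⟨i, by omega⟩ ⟨p + 1, by omega⟩ ⟨i, by omega⟩ ⟨p, hp⟩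
              (by simp only []; omega) rfl rfl,
            ← (F _).face_face ⟨i, by omega⟩ ⟨q + 1, by omega⟩ ⟨i, by omega⟩ ⟨q, hq⟩
              (by simp only []; omega) rfl rfl,
            hF ⟨p + 1, by omega⟩ ⟨q + 1 + 1, by omega⟩ ⟨p + 1, by omega⟩ ⟨q + 1, by omega⟩
              (by simp only []; omega) (by simp only []; omega) (by simp only []; omega) rfl rfl])
    (by
      rintro _ ⟨a, ⟨ha, haF⟩, rfl⟩ ⟨k, hk⟩
      simp only []
      by_cases h : k < i
      · rw [hG1 k hk h, ha.apply_apply ⟨k, by omega⟩ ⟨i, hi⟩ ⟨k, hk⟩ ⟨i - 1, by omega⟩ h rfl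
          (by simp only []; omega)]
        exact Simplex.apply_mem_face (haF _ (by simp only []; omega)) _
      · rw [hG2 k hk h, ← ha.apply_apply ⟨i, hi⟩ ⟨k + 1, by omega⟩ ⟨i, by omega⟩ ⟨k, hk⟩
          (by simp only []; omega) rfl rfl]
        exact Simplex.apply_mem_face (haF _ (by simp only []; omega)) _)
  have hyG : ∀ k, y.face k = G k := fun k => rfl
  have hye : y.elem = (fun a => a ⟨i, hi⟩) '' E := rfl
  let F' : Fin (m + 4) → Simplex 𝒱 (m + 2) := fun j => if j.val = i then y else F j
  have hF'i : F' ⟨i, hi⟩ = y := if_pos rfl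
  have hF' : ∀ j, j.val ≠ i → F' j = F j := fun j hj => if_neg hj
  let w : Simplex 𝒱 (m + 3) := Simplex.mk F' E (by
      rintro ⟨p, hp⟩ ⟨q, hq⟩ hpq
      have hpq : p ≤ q := hpq
      simp only [Fin.succ_mk, Fin.castSucc_mk]
      by_cases hpi : p = i
      · subst hpi
        rw [hF'i, hyG, hG2 q _ (by omega), hF' _ (by simp only []; omega)]
      · rw [hF' ⟨p, _⟩ hpi]
        by_cases hqi : q + 1 = i
        · subst hqi
          rw [hF'i, hyG, hG1 p _ (by omega)]
          rfl
        · rw [hF' _ hqi]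
          exact hF _ _ _ _ hpi hqi (by simp only []; omega) rfl rfl)
    (fun a ha j => by
      by_cases hj : j.val = i
      · obtain rfl : j = ⟨i, hi⟩ := Fin.ext hj
        rw [hF'i, hye]
        exact ⟨a, ha, rfl⟩
      · rw [hF' j hj]
        exact ha.2 j hj)
  have hwF : ∀ j, w.face j = F' j := fun j => rfl
  have hwe : w.elem = E := rfl
  refine ⟨w, ⟨hi, fun a ha => ha.1, fun a ha haw => ?_, fun c => ?_⟩, hF'⟩
  · have haE : a ∈ E := ⟨ha, fun j hj => by
      have := haw j hj
      rwa [hwF, hF' j hj] at this⟩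
    rw [hwF, hF'i, hye]
    exact ⟨⟨a, haE, rfl⟩, haE⟩
  · rw [hwF, hF'i, hye]
    rfl

/-! ### The subcomplex generated by composition -/

section Extension

open SimplicialSystem

/-- The subcomplex generated by composition from a truncated subcomplex: its simplices in each
dimension. -/
def extension (i : ℕ) {n : ℕ} (T : (relationComplex 𝒱).TruncSubcomplex n) :
    ∀ m : ℕ, Set (Simplex 𝒱 m)
  | 0 => {w | w ∈ T.carrier 0 (Nat.zero_le n)}
  | m + 1 => {w | (∃ h : m + 1 ≤ n, w ∈ T.carrier (m + 1) h) ∨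
      (n ≤ m ∧ IsComposition i w ∧ ∀ j, j.val ≠ i → w.face j ∈ extension i T m)}

variable {i n : ℕ} {T : (relationComplex 𝒱).TruncSubcomplex n}

theorem mem_extension_of_le {m : ℕ} (h : m ≤ n) {w : Simplex 𝒱 m} :
    w ∈ extension i T m ↔ w ∈ T.carrier m h := by
  cases m with
  | zero => exact Iff.rfl
  | succ m =>
    refine ⟨?_, fun hw => Or.inl ⟨h, hw⟩⟩
    rintro (⟨_, hw⟩ | ⟨h', -⟩)
    · exact hw
    · omega

theorem mem_extension_succ {m : ℕ} (h : n ≤ m) {w : Simplex 𝒱 (m + 1)} :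
    w ∈ extension i T (m + 1) ↔
      IsComposition i w ∧ ∀ j, j.val ≠ i → w.face j ∈ extension i T m := by
  refine ⟨?_, fun hw => Or.inr ⟨h, hw⟩⟩
  rintro (⟨h', -⟩ | ⟨-, hw⟩)
  · omega
  · exact hw

/-- The faces `i - 2` and `i + 1`, neither of which is the `i`-th, already force the relation;
`i`-surjectivity makes the `i`-th face the projection. -/
theorem ComposerConditions.isComposition {n i : ℕ} {y : Simplex 𝒱 (n + 2)} (hi : 1 < i)
    (hin : i < n + 2) (hy : ComposerConditions i y) : IsComposition i y := by
  obtain ⟨hsub, hlift, -, hfill⟩ := (composerConditions_iff hi hin).1 hy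
  exact isComposition_of_rel hsub hy.2.1 fun x hx =>
    hfill x (hx _ (by omega) (by omega)) (hx _ (by omega) (by omega))

/-- The three claims need one another: closure under faces and degeneracies uses the conditions one
dimension lower, and degeneracies use faces. -/
theorem extension_spec {N : ℕ} {T : (relationComplex 𝒱).TruncSubcomplex (N + 2)} (hi : 1 < i)
    (hin : i < N + 2) (hT : ∀ y ∈ T.carrier (N + 2) le_rfl, ComposerConditions i y)
    (hsat : Saturated i (T.carrier (N + 2) le_rfl)) (k : ℕ) (hk : N ≤ k) :
    (∀ y ∈ extension i T (k + 2), StrongConditions i y) ∧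
    (∀ y ∈ extension i T (k + 2), ∀ j, y.face j ∈ extension i T (k + 1)) ∧
    (∀ y ∈ extension i T (k + 1), ∀ j, y.deg j ∈ extension i T (k + 2)) := by
  induction k, hk using Nat.le_induction with
  | base =>
    have hd : ∀ y ∈ T.carrier (N + 2) le_rfl, ∀ j, Simplex.face j y ∈ T.carrier (N + 1) (by omega) :=
      fun y hy j => T.d_mem le_rfl j y hy
    have hs : ∀ y ∈ T.carrier (N + 1) (by omega), ∀ j, Simplex.deg j y ∈ T.carrier (N + 2) le_rfl :=
      fun y hy j => T.s_mem le_rfl j y hy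
    simp only [mem_extension_of_le (le_refl (N + 2)), mem_extension_of_le (Nat.le_succ (N + 1))]
    refine ⟨fun y hy => ?_, hd, hs⟩
    obtain ⟨h1, h2, h3, h4⟩ := (composerConditions_iff hi hin).1 (hT y hy)
    exact ⟨h1, h2, h3, h4, fills_of_fills_deg hi hin h1 h4
      ((composerConditions_iff hi hin).1 (hT _ (hs _ (hd y hy _) _))).2.2.2⟩
  | succ k hk ih =>
    obtain ⟨ihc, ihd, ihs⟩ := ih
    have hin' : i < k + 2 := by omega
    have H : ∀ w ∈ extension i T (k + 3), IsComposition i w ∧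
        ∀ (j : ℕ) (hj : j < k + 4), j ≠ i → StrongConditions i (w.face ⟨j, hj⟩) := by
      intro w hw
      rw [mem_extension_succ (by omega)] at hw
      exact ⟨hw.1, fun j hj hji => ihc _ (hw.2 _ hji)⟩
    refine ⟨fun w hw => (H w hw).1.strongConditions hi hin' (H w hw).2, fun w hw j => ?_,
      fun y hy j => ?_⟩
    · have hwf := ((mem_extension_succ (by omega)).1 hw).2
      by_cases hj : j.val = i
      · have hcc := (H w hw).1.composerConditions_face hi hin' (H w hw).2 j hj
        -- Saturation is needed only when the composite has the truncation dimension. Above it the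
        -- composite is itself a composition, with faces that are faces of factors.
        rcases hk.eq_or_lt with rfl | hk'
        · rw [mem_extension_of_le le_rfl]
          exact hsat w (H w hw).1
            (fun j hj => (mem_extension_of_le le_rfl).1 (hwf j hj)) j hj hcc
        · refine (mem_extension_succ (by omega)).2 ⟨hcc.isComposition hi hin', fun l _ => ?_⟩
          rcases lt_or_ge l.val i with hl | hl
          · rw [w.face_face ⟨l.val, by omega⟩ j l ⟨i - 1, by omega⟩ (by simp only []; omega) rfl
              (by simp only []; omega)]
            exact ihd _ (hwf _ (by simp only []; omega)) _
          · rw [← w.face_face j ⟨l.val + 1, by omega⟩ ⟨i, by omega⟩ l (by simp only []; omega)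
              hj.symm rfl]
            exact ihd _ (hwf _ (by simp only []; omega)) _
      · exact hwf j hj
    · have hc := ihc y hy
      refine (mem_extension_succ (by omega)).2 ⟨isComposition_deg hc.subfaceSimplicial (by omega)
        hc.lifts hc.lifts_pred j, fun l _ => ?_⟩
      rcases y.face_deg_cases l j with h | ⟨l', j', h⟩
      · rwa [h]
      · rw [h]
        exact ihs _ (ihd y hy l') j'

end Extension

end SetRelations

/-! ### The main theorem -/

open SetRelations SimplicialSystem in
theorem mainTheorem1 {U : Type u} (𝒱 : Set (Set U)) (n i : ℕ) (hi : 1 < i) (hin : i < n)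
    (T : (SetRelations.relationComplex 𝒱).TruncSubcomplex n)
    (hT : ∀ y ∈ T.carrier n le_rfl, SetRelations.ComposerConditions i y)
    (hsat : SetRelations.Saturated i (T.carrier n le_rfl)) :
    ∃ S' : (SetRelations.relationComplex 𝒱).Subcomplex,
      S'.trunc n = T ∧
      S'.toSystem.IsComposer n i ∧
      ∀ m : ℕ, n ≤ m → ∀ w : SetRelations.Simplex 𝒱 (m + 1),
        w ∈ S'.carrier (m + 1) ↔
          SetRelations.IsComposition i w ∧
            ∀ j : Fin (m + 2), j.val ≠ i → w.face j ∈ S'.carrier m := by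
  obtain ⟨N, rfl⟩ : ∃ N, n = N + 2 := ⟨n - 2, by omega⟩
  have spec := extension_spec hi hin hT hsat
  let S : (relationComplex 𝒱).Subcomplex :=
    { carrier := extension i T
      d_mem := fun {m} j x hx => by
        by_cases hm : m + 1 ≤ N + 2
        · rw [mem_extension_of_le hm] at hx
          rw [mem_extension_of_le (by omega)]
          exact T.d_mem hm j x hx
        · obtain ⟨k, rfl⟩ : ∃ k, m = k + 1 := ⟨m - 1, by omega⟩
          exact (spec k (by omega)).2.1 x hx j
      s_mem := fun {m} j x hx => by
        by_cases hm : m + 1 ≤ N + 2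
        · rw [mem_extension_of_le (by omega)] at hx
          rw [mem_extension_of_le hm]
          exact T.s_mem hm j x hx
        · obtain ⟨k, rfl⟩ : ∃ k, m = k + 1 := ⟨m - 1, by omega⟩
          exact (spec k (by omega)).2.2 x hx j }
  refine ⟨S, ?_, fun m hm => ?_, fun m hm w => mem_extension_succ hm⟩
  · ext m hm w
    exact mem_extension_of_le hm
  obtain ⟨k, rfl⟩ : ∃ k, m = k + 2 := ⟨m - 2, by omega⟩
  constructor
  · rintro ⟨w, hw⟩ ⟨z, hz⟩ h
    refine Subtype.ext (IsComposition.ext ((mem_extension_succ hm).1 hw).1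
      ((mem_extension_succ hm).1 hz).1 fun j hj => ?_)
    exact congrArg Subtype.val (congrFun (congrArg Subtype.val h) ⟨j, hj⟩)
  · rintro ⟨x, hx⟩
    obtain ⟨w, hw, hwx⟩ := exists_isComposition (𝒱 := 𝒱) (m := k) (i := i) (by omega)
      -- The value at position `i` is arbitrary; position 0 is available because `i > 1`.
      (fun j => if hj : j.val ≠ i then (x ⟨j, hj⟩).1
        else (x ⟨⟨0, by omega⟩, by simp only []; omega⟩).1) (by
        intro p q p' q' hp hq hpq hp' hq'
        obtain rfl : q = q'.succ := Fin.ext (by simp [hq'])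
        obtain rfl : p = p'.castSucc := Fin.ext (by simp [hp'])
        simp only [dif_pos hp, dif_pos hq]
        exact congrArg Subtype.val (hx p' q' hp hq (by
          simp only [Fin.val_castSucc, Fin.val_succ] at hpq
          exact Nat.lt_succ_iff.mp hpq)))
    have hwx' : ∀ (j : Fin (k + 4)) (hj : j.val ≠ i), w.face j = (x ⟨j, hj⟩).1 := fun j hj =>
      (hwx j hj).trans (dif_pos hj)
    refine ⟨⟨w, (mem_extension_succ hm).2 ⟨hw, fun j hj => ?_⟩⟩, ?_⟩
    · rw [hwx' j hj]
      exact (x ⟨j, hj⟩).2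
    · exact Subtype.ext (funext fun j => Subtype.ext (hwx' j.1 j.2))
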